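/- **Setting.** Let $\Pi$ be a finite nonempty decision space, $\mathcal Z$ a measurable space of outcomes $z=(r,o)$ (reward and observation) with measurable reward $r\in[0,1]$, and $\mathcal M$ a nonempty class of models $M:\Pi\to\Delta(\mathcal Z)$; write $f^M(\pi)=\mathbb E_{z\sim M(\pi)}[r]$. In each round $t=1,\dots,T$ the learner chooses $p^t\in\Delta(\Pi)$ as a function of the past pairs $(\pi^i,z^i)$, an adaptive adversary chooses $M^t\in\mathcal M$ from the past (and possibly private randomness), and then $\pi^t\sim p^t$, $z^t\sim M^t(\pi^t)$. The regret is $$\mathrm{Reg}_{\mathsf{DM}}=\max_{\pi^\star\in\Pi}\sum_{t=1}^T\mathbb E_{\pi\sim p^t}\big[f^{M^t}(\pi^\star)-f^{M^t}(\pi)\big].$$ Let $\mathrm{co}(\mathcal M)$ be the set of finitely supported mixtures of models in $\mathcal M$, let $D_{\mathsf H}^2(P,Q)=\int(\sqrt{dP}-\sqrt{dQ})^2$, and $$\mathrm{dec}_\gamma(\mathcal N)=\sup_{\bar M\in\mathcal N}\ \inf_{p\in\Delta(\Pi)}\ \sup_{M\in\mathcal N}\ \mathbb E_{\pi\sim p}\Big[\max_{\pi'}f^M(\pi')-f^M(\pi)-\gamma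 D_{\mathsf H}^2\big(M(\pi),\bar M(\pi)\big)\Big].$$ **Regularity of $\mathcal M$.** Call a class $\mathcal N$ of models *dominated* if $\mathcal Z$ has a partition into measurable cells $Z_i$, $i\in I$ (with $I$ possibly uncountable), such that a set is measurable as soon as its intersection with every cell is, and there are $\sigma$-finite measures $\nu_i$ such that each $M(\pi)$, $M\in\mathcal N$, is concentrated on countably many cells and is absolutely continuous with respect to $\nu_i$ on each of these. (This covers domination by a single $\sigma$-finite measure, and countably supported $M(\pi)$ when all subsets of $\mathcal Z$ are measurable.) It is assumed that there are Markov kernels $K_\pi$ on $\mathcal Z$, $\pi\in\Pi$, such that the models $\pi\mapsto K_\pi\circ M(\pi)$, $M\in\mathcal M$, have the same mean reward functions as $M$, belong to $\mathrm{co}(\mathcal M)$ and form a dominated class. (If $\mathcal M$ is dominated, let $K_\pi$ be the identity. If $\mathcal M$ consists of all reward distributions on $[0,1]$ with means in a given function class, let $K_\pi$ round the reward $r$ to a Bernoulli variable of mean $r$.) **Algorithm $\mathsf{ExO}^+$** with learning rate $\eta>0$. In round $t$, let $q^t(\pi)\propto\exp\big(\eta\sum_{i<t}\hat f^i(\pi)\big)$;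 choose $p^t\in\Delta(\Pi)$ and $g^t:\Pi\times\Pi\times\mathcal Z\to\mathbb R$ (measurably) to minimize $\sup_{M\in\mathcal M,\pi^\star\in\Pi}\Gamma_{q^t,\eta}(p,g;\pi^\star,M)$ over all $p$ and all measurable $g$, where $$\Gamma_{q,\eta}(p,g;\pi^\star,M)=\mathbb E_{\pi\sim p}\big[f^M(\pi^\star)-f^M(\pi)\big]+\frac1\eta\,\mathbb E_{\pi\sim p,\,z\sim M(\pi)}\mathbb E_{\pi'\sim q}\Big[\exp\Big(\frac{\eta}{p(\pi)}\big(g(\pi';\pi,z)-g(\pi^\star;\pi,z)\big)\Big)-1\Big];$$ sample $\pi^t\sim p^t$, observe $z^t$, and set $\hat f^t(\pi)=g^t(\pi;\pi^t,z^t)/p^t(\pi^t)$. As the minimum need not be attained, the minimization may be carried out up to an additive error $\varepsilon\ge0$; $\varepsilon=0$ means an exact minimizer. **Theorem (main upper bound).** There is a universal constant $C>0$ such that the following holds for all $\Pi,\mathcal Z,\mathcal M$ as above and all $T$. 1. For all $\eta>0$, $\varepsilon\ge 0$ and every run of $\mathsf{ExO}^+$ with learning rate $\eta$ and error $\varepsilon$: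 for all $\delta>0$ and every adaptive adversary, with probability at least $1-\delta$, $$\mathrm{Reg}_{\mathsf{DM}}\le \mathrm{dec}_{1/(8\eta)}(\mathrm{co}(\mathcal M))\cdot T+\frac2\eta\log\frac{|\Pi|}{\delta}+\varepsilon T .$$ In particular, the bound holds without the last term for exact minimizers. 2. For all $\eta,\varepsilon>0$ the algorithm $\mathsf{ExO}^+$ with error $\varepsilon$ can be realized by measurable choices. 3. Let $V_\delta=\inf_{\gamma>0}\{\mathrm{dec}_\gamma(\mathrm{co}(\mathcal M))\,T+\gamma\log(|\Pi|/\delta)\}$. For every $\delta>0$ with $V_\delta>0$ there are $\eta>0$ and $\varepsilon_0>0$ such that every $\mathsf{ExO}^+$ with learning rate $\eta$ and error $\varepsilon\in[0,\varepsilon_0]$ ensures, against every adaptive adversary, $\mathrm{Reg}_{\mathsf{DM}}\le C\,V_\delta$ with probability at least $1-\delta$. For all $\delta,\varepsilon>0$ (also if $V_\delta=0$) there is $\eta>0$ such that this bound is ensured by some $\mathsf{ExO}^+$ with learning rate $\eta$ and error $\varepsilon$. -/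

import Mathlib

open MeasureTheory ProbabilityTheory
open scoped ENNReal NNReal

universe u v w

noncomputable section

namespace AdvDM

/-- A model: a probability kernel from the (finite) decision space `D` to the outcome space `Z`.
An outcome `z = (r, o)` comprises the reward and the observation; the reward coordinate is
given throughout by a map `r : Z → ℝ`. -/
abbrev Model (D Z : Type*) [MeasurableSpace Z] := D → ProbabilityMeasure Z

section Complexity

variable {D Z : Type*} [MeasurableSpace Z]

/-- Mean reward `f^M(π) = E_{z ∼ M(π)}[r]`. -/
def meanReward (r : Z → ℝ) (M : Model D Z) (π : D) : ℝ :=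
  ∫ z, r z ∂(M π : Measure Z)

/-- Squared Hellinger distance, computed with the dominating measure `P + Q`. -/
def hellingerSq (P Q : Measure Z) : ℝ :=
  ∫ z, (√((P.rnDeriv (P + Q) z).toReal) - √((Q.rnDeriv (P + Q) z).toReal)) ^ 2 ∂(P + Q)

/-- The convex hull `co(𝓜)`: all finitely supported mixtures of models in `𝓜`. -/
def co (𝓜 : Set (Model D Z)) : Set (Model D Z) :=
  {N | ∃ (n : ℕ) (w : Fin n → ℝ≥0) (M : Fin n → Model D Z),
    (∑ i, w i = 1) ∧ (∀ i, M i ∈ 𝓜) ∧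
    ∀ π, (N π : Measure Z) = ∑ i, w i • (M i π : Measure Z)}

/-- `𝓝` has a common dominating measure. The dominating measure need not be `σ`-finite: it may
be `σ`-finite (`ν i`) on each cell of a partition of `Z` into possibly uncountably many cells
such that a set is measurable as soon as its trace on each cell is, each distribution `M(π)`
charging only countably many cells. One cell: domination by a single `σ`-finite measure.
Singleton cells: all subsets of `Z` are measurable and each `M(π)` is countably supported. -/
def Dominated {D : Type*} {Z : Type v} [MeasurableSpace Z] (𝓝 : Set (Model D Z)) : Prop :=
  ∃ (ι : Type v) (cell : Z → ι) (ν : ι → Measure Z),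
    (∀ i, MeasurableSet (cell ⁻¹' {i})) ∧
    (∀ A : Set Z, (∀ i, MeasurableSet (A ∩ cell ⁻¹' {i})) → MeasurableSet A) ∧
    (∀ i, SigmaFinite (ν i)) ∧
    ∀ M ∈ 𝓝, ∀ π : D, ∃ S : Set ι, S.Countable ∧ (M π : Measure Z) (cell ⁻¹' S)ᶜ = 0 ∧
      ∀ i ∈ S, (M π : Measure Z).restrict (cell ⁻¹' {i}) ≪ ν i

/-- Regularity of a model class: it has a common dominating measure (take `K π` to be the
identity kernel), possibly only after a randomised rounding `K π` of the outcomes which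
preserves mean rewards and keeps the models in `co(𝓜)`. (Example: all reward distributions on
`[0,1]` with means in a given class of functions, with `r` rounded to a Bernoulli variable of
mean `r`.) -/
def RegularClass {D : Type*} {Z : Type v} [MeasurableSpace Z] (r : Z → ℝ)
    (𝓜 : Set (Model D Z)) : Prop :=
  ∃ K : D → Kernel Z Z, (∀ π, IsMarkovKernel (K π)) ∧
    ∃ 𝓝 : Set (Model D Z), 𝓝 ⊆ co 𝓜 ∧ Dominated 𝓝 ∧
      ∀ M ∈ 𝓜, ∃ N ∈ 𝓝, ∀ π,
        (N π : Measure Z) = (M π : Measure Z).bind (K π) ∧ meanReward r N π = meanReward r M π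

variable [Fintype D]

/-- `dec_γ(𝓝, M̄)`. All quantities are bounded, so `⨅` and `⨆` are the genuine ones. -/
def decAt (r : Z → ℝ) (γ : ℝ) (𝓝 : Set (Model D Z)) (Mbar : Model D Z) : ℝ :=
  ⨅ p : stdSimplex ℝ D, ⨆ M : 𝓝, ∑ π, p.1 π *
    ((⨆ π', meanReward r M.1 π') - meanReward r M.1 π
      - γ * hellingerSq (M.1 π : Measure Z) (Mbar π : Measure Z))

/-- The Decision-Estimation Coefficient `dec_γ(𝓝) = sup_{M̄ ∈ 𝓝} dec_γ(𝓝, M̄)`. -/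
def dec (r : Z → ℝ) (γ : ℝ) (𝓝 : Set (Model D Z)) : ℝ :=
  ⨆ Mbar : 𝓝, decAt r γ 𝓝 Mbar.1

/-- The high-probability exploration-by-optimization objective `Γ_{q,η}(p, g; π⋆, M)`, with
`g π' π z` standing for `g(π'; π, z)`. The exponential moment may be `+∞`. -/
def exoObj (r : Z → ℝ) (η : ℝ) (q p : D → ℝ) (g : D → D → Z → ℝ) (πs : D) (M : Model D Z) :
    EReal :=
  ((∑ π, p π * (meanReward r M πs - meanReward r M π) : ℝ) : EReal)
    + ((ENNReal.ofReal (1 / η) * ∑ π, ENNReal.ofReal (p π) *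
        ∫⁻ z, ∑ π', ENNReal.ofReal (q π' * Real.exp (η / p π * (g π' π z - g πs π z)))
          ∂(M π : Measure Z) : ℝ≥0∞) : EReal)
    - ((1 / η : ℝ) : EReal)

/-- `sup_{M ∈ 𝓜, π⋆} Γ_{q,η}(p, g; π⋆, M)`. -/
def exoSup (r : Z → ℝ) (η : ℝ) (𝓜 : Set (Model D Z)) (q p : D → ℝ) (g : D → D → Z → ℝ) :
    EReal :=
  ⨆ M ∈ 𝓜, ⨆ πs : D, exoObj r η q p g πs M

/-- The minimax value `exo_η(𝓜, q)`. -/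
def exo (r : Z → ℝ) (η : ℝ) (𝓜 : Set (Model D Z)) (q : D → ℝ) : EReal :=
  ⨅ p ∈ stdSimplex ℝ D, ⨅ (g : D → D → Z → ℝ) (_ : ∀ π' π, Measurable (g π' π)),
    exoSup r η 𝓜 q p g

/-- `(p, g)` minimizes the objective up to an additive error `ε`; for `ε = 0` it is an exact
minimizer. -/
def IsExoMin (r : Z → ℝ) (η ε : ℝ) (𝓜 : Set (Model D Z)) (q p : D → ℝ)
    (g : D → D → Z → ℝ) : Prop :=
  p ∈ stdSimplex ℝ D ∧ (∀ π' π, Measurable (g π' π)) ∧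
    exoSup r η 𝓜 q p g ≤ exo r η 𝓜 q + ((ε : ℝ) : EReal)

end Complexity

section Protocol

variable {D Z : Type*} [MeasurableSpace D] [MeasurableSpace Z]

/-- A learner: in round `t = 0, 1, …` it maps the history of the `t` past pairs `(π, z)` to a
sampling distribution `p` and an estimation function `g`, measurably. -/
structure Learner (D Z : Type*) [MeasurableSpace D] [MeasurableSpace Z] where
  p : (t : ℕ) → (Fin t → D × Z) → D → ℝ
  g : (t : ℕ) → (Fin t → D × Z) → D → D → Z → ℝ
  measurable_p : ∀ t π, Measurable fun h => p t h π
  measurable_g : ∀ t π' π, Measurable fun x : (Fin t → D × Z) × Z => g t x.1 π' π x.2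

/-- The importance-weighted reward estimator of round `i < t`, for a history `h` of length `t`. -/
def Learner.est (L : Learner D Z) {t : ℕ} (h : Fin t → D × Z) (i : Fin t) (π : D) : ℝ :=
  L.g i (fun j => h (Fin.castLE i.2.le j)) π (h i).1 (h i).2
    / L.p i (fun j => h (Fin.castLE i.2.le j)) (h i).1

variable [Fintype D]

/-- The exponential weights distribution `q` of round `t`, after the history `h`. -/
def Learner.expWeights (L : Learner D Z) (η : ℝ) {t : ℕ} (h : Fin t → D × Z) (π : D) : ℝ :=
  Real.exp (η * ∑ i, L.est h i π) / ∑ π', Real.exp (η * ∑ i, L.est h i π')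

/-- `L` is the algorithm ExO⁺ with learning rate `η` over `T` rounds, its optimization step
being solved up to an additive error `ε` (exactly, if `ε = 0`). -/
def IsExOPlus (r : Z → ℝ) (η ε : ℝ) (𝓜 : Set (Model D Z)) (T : ℕ) (L : Learner D Z) : Prop :=
  ∀ t < T, ∀ h : Fin t → D × Z, IsExoMin r η ε 𝓜 (L.expWeights η h) (L.p t h) (L.g t h)

/-- A run of the `T`-round protocol on a probability space, against an adaptive adversary.
`ℱ t` is the information available to the adversary before round `t` (past actions and outcomes,
and any private randomness). The adversary selects `model t ∈ 𝓜` from that information, and,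
conditionally on `ℱ t`, the decision `π` of round `t` has law `p t` and the outcome law
`(model t)(π)`. -/
structure Interaction (𝓜 : Set (Model D Z)) (L : Learner D Z) (T : ℕ)
    {Ω : Type*} [mΩ : MeasurableSpace Ω] (P : Measure Ω) where
  ℱ : Filtration ℕ mΩ
  model : ℕ → Ω → Model D Z
  act : ℕ → Ω → D
  out : ℕ → Ω → Z
  model_mem : ∀ t < T, ∀ ω, model t ω ∈ 𝓜
  measurable_model : ∀ t < T, ∀ π, Measurable[ℱ t] fun ω => (model t ω π : Measure Z)
  measurable_act : ∀ t < T, Measurable[ℱ (t + 1)] (act t)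
  measurable_out : ∀ t < T, Measurable[ℱ (t + 1)] (out t)
  law : ∀ t < T, ∀ E : Set Ω, MeasurableSet[ℱ t] E → ∀ (π : D) (A : Set Z), MeasurableSet A →
    P (E ∩ {ω | act t ω = π ∧ out t ω ∈ A}) =
      ∫⁻ ω in E, ENNReal.ofReal (L.p t (fun i : Fin t => (act i ω, out i ω)) π)
        * (model t ω π : Measure Z) A ∂P

/-- The regret `Reg_DM` to the best fixed decision in hindsight. -/
def Interaction.regret {𝓜 : Set (Model D Z)} {L : Learner D Z} {T : ℕ} {Ω : Type*}
    [MeasurableSpace Ω] {P : Measure Ω} (I : Interaction 𝓜 L T P) (r : Z → ℝ) (ω : Ω) : ℝ :=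
  ⨆ πs : D, ∑ t ∈ Finset.range T, ∑ π,
    L.p t (fun i : Fin t => (I.act i ω, I.out i ω)) π
      * (meanReward r (I.model t ω) πs - meanReward r (I.model t ω) π)

/-- With probability at least `1 - δ` the regret of `L` over `T` rounds is at most `B`, against
every adaptive adversary that selects models in `𝓜`. -/
def RegretBound (r : Z → ℝ) (𝓜 : Set (Model D Z)) (T : ℕ) (L : Learner D Z) (δ B : ℝ) : Prop :=
  ∀ (Ω : Type w) [MeasurableSpace Ω] (P : Measure Ω) [IsProbabilityMeasure P]
    (I : Interaction 𝓜 L T P), ENNReal.ofReal (1 - δ) ≤ P {ω | I.regret r ω ≤ B}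

/-- `inf_{γ > 0} { dec_γ(co(𝓜)) T + γ log(|D| / δ) }`. -/
def decTradeoff (r : Z → ℝ) (𝓜 : Set (Model D Z)) (T : ℕ) (δ : ℝ) : ℝ :=
  ⨅ γ : {γ : ℝ // 0 < γ}, (dec r γ (co 𝓜) * T + γ * Real.log (Fintype.card D / δ))

end Protocol

end AdvDM

end

/-! The theorem combines two facts: the minimax value of the per-round problem is at most
dec_{1/(8η)}(co(𝓜)), and a learner whose objective stays below b in every round has regret at most
bT + (2/η) log(|Π|/δ) with probability at least 1 - δ.

Value. Put u(a, π, z) = p(π) ∑ q(π') exp((η/p(π)) (g(π'; π, z) - g(a; π, z))). The objective is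
linear in (p, u) (`linObj`), and where p(π) > 0 such u satisfy p(π) ∑ q(a)/u(a, π, z) = 1. Relaxing
this to ≤ 1 costs nothing, since g = -(p/η) log u recovers an estimator
(`Admissible.exists_estimator`), and in dual form the relaxed constraint is convex and weakly closed
(`Admissible`). Against a known prior on pairs (M, a), let m be the law of a, N_a the conditional
mixture model, Q the total mixture and ρ_a(z) the posterior of a. The learner takes p nearly optimal
for the reference model Q, and weights w_a proportional to √(q_a/ρ_a), normalized so that ∑ q_a/w_a
= 1. Their expected cost is ∑ ∫ √(q_a ρ_a) dQ ≤ 1 - (1/8) ∑ m_a D_H²(N_a, Q); divided by η, the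
saving is exactly the Hellinger penalty of the coefficient with γ = 1/(8η)
(`exists_posterior_weights`, `exists_admissible_of_mixture`). For finitely many pairs (M, a),
separation of convex sets removes the knowledge of the prior (`exists_forall_le_of_convex`). Weak-*
limits along an ultrafilter of finite sets reach a whole dominated class, cell by cell
(`exists_admissible_of_dominated`), and averaging u over the rounding kernels carries the solution
to 𝓜 (`exists_admissible_of_regular`).

Regret. If the objective is at most b, the conditional mean of the exponential factor is at most 1 +
η(b - R) ≤ exp(η(b - R)), with R the instantaneous regret. So the product of the terms exp(η(R - b))
times the factors is a supermartingale. With exponential weights the product of the factors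
telescopes and is at least 1/|Π| on every path; Markov's inequality and a union bound over the
comparator finish the argument (`Interaction.regret_bound`).

Realization and tuning. The objective is stable under multiplicative perturbations of q, so one
approximate minimizer per cell of a countable partition gives a measurable choice. For positive V_δ,
η = 1/(8γ) with γ nearly optimal suffices; if V_δ = 0, some fixed p has no regret at all, and it is
an ε-minimizer for η = 1/ε. -/

noncomputable section

namespace AdvDM

open Filter Topology

/-- Bounded real functions converge along ultrafilters. -/
theorem exists_tendsto_ultrafilter {α : Type*} (𝒰 : Ultrafilter α) (f : α → ℝ) (a b : ℝ)
    (h : ∀ x, f x ∈ Set.Icc a b) : ∃ l ∈ Set.Icc a b, Tendsto f 𝒰 (𝓝 l) := by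
  obtain ⟨l, hl, hle⟩ := (isCompact_Icc (a := a) (b := b)).ultrafilter_le_nhds (𝒰.map f)
    (le_principal_iff.2 (Filter.mem_map.2 (Filter.univ_mem' h)))
  exact ⟨l, hl, hle⟩

/-! ### Weak-* limits of bounded functions along ultrafilters -/

section WeakLimit

variable {α Z : Type*} [MeasurableSpace Z]

theorem integrable_of_mem_Icc {m : Measure Z} [IsFiniteMeasure m] {f : Z → ℝ} {B : ℝ}
    (hf : Measurable f) (h0 : ∀ z, 0 ≤ f z) (hB : ∀ z, f z ≤ B) : Integrable f m :=
  Integrable.of_bound hf.aestronglyMeasurable B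
    (Eventually.of_forall fun z => by rw [Real.norm_of_nonneg (h0 z)]; exact hB z)

theorem integral_le_mul_real {m : Measure Z} [IsFiniteMeasure m] {f : Z → ℝ} {B : ℝ}
    (hf : Measurable f) (h0 : ∀ z, 0 ≤ f z) (hB : ∀ z, f z ≤ B) :
    ∫ z, f z ∂m ≤ B * m.real Set.univ := by
  calc ∫ z, f z ∂m ≤ ∫ _, B ∂m :=
        integral_mono (integrable_of_mem_Icc hf h0 hB) (integrable_const _) hB
    _ = B * m.real Set.univ := by rw [integral_const, smul_eq_mul, mul_comm]

/-- The set function `A ↦ lim ∫_A u dν` along an ultrafilter is a measure. -/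
theorem exists_limit_measure (𝒰 : Ultrafilter α) (ν : Measure Z) [IsFiniteMeasure ν] (B : ℝ)
    (u : α → Z → ℝ) (hu : ∀ F, Measurable (u F)) (h0 : ∀ F z, 0 ≤ u F z)
    (hB : ∀ F z, u F z ≤ B) :
    ∃ ρ : Measure Z, ∀ A, MeasurableSet A → ρ A ≤ ENNReal.ofReal (B * ν.real A) ∧
      Tendsto (fun F => ∫ z in A, u F z ∂ν) 𝒰 (𝓝 (ρ A).toReal) := by
  have key : ∀ A : Set Z, ∃ l ∈ Set.Icc 0 (B * ν.real A),
      Tendsto (fun F => ∫ z in A, u F z ∂ν) 𝒰 (𝓝 l) := by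
    intro A
    refine exists_tendsto_ultrafilter 𝒰 _ _ _ fun F => ⟨integral_nonneg (h0 F), ?_⟩
    simpa using integral_le_mul_real (m := ν.restrict A) (hu F) (h0 F) (hB F)
  choose l hl hlim using key
  refine ⟨Measure.ofMeasurable (fun A _ => ENNReal.ofReal (l A)) ?_ ?_, fun A hA => ?_⟩
  · have := (hl ∅).2
    simp only [measureReal_empty, mul_zero] at this
    exact ENNReal.ofReal_of_nonpos this
  · intro f hf hd
    have hsum : HasSum (fun i => ν.real (f i)) (ν.real (⋃ i, f i)) := by
      have h1 : ν (⋃ i, f i) = ∑' i, ν (f i) := measure_iUnion hd hf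
      have h2 : (∑' i, ν (f i)) ≠ ∞ := h1 ▸ measure_ne_top _ _
      have h3 := ENNReal.hasSum_toReal h2
      rw [← ENNReal.tsum_toReal_eq (fun i => measure_ne_top _ _), ← h1] at h3
      exact h3
    -- This majorant does not depend on F, so dominated convergence for series carries countable
    -- additivity through the limit.
    have hs : Summable fun i => B * ν.real (f i) := hsum.summable.mul_left B
    have h1 : Tendsto (fun F => ∑' i, ∫ z in f i, u F z ∂ν) 𝒰 (𝓝 (∑' i, l (f i))) := by
      refine tendsto_tsum_of_dominated_convergence hs (fun i => hlim (f i))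
        (Eventually.of_forall fun F i => ?_)
      rw [Real.norm_of_nonneg (integral_nonneg (h0 F))]
      simpa using integral_le_mul_real (m := ν.restrict (f i)) (hu F) (h0 F) (hB F)
    have h2 : (fun F => ∑' i, ∫ z in f i, u F z ∂ν) = fun F => ∫ z in ⋃ i, f i, u F z ∂ν := by
      ext F
      exact (integral_iUnion hf hd (integrable_of_mem_Icc (hu F) (h0 F) (hB F)).integrableOn).symm
    rw [h2] at h1
    have h3 : l (⋃ i, f i) = ∑' i, l (f i) := tendsto_nhds_unique (hlim _) h1
    show ENNReal.ofReal (l (⋃ i, f i)) = ∑' i, ENNReal.ofReal (l (f i))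
    rw [h3]
    exact ENNReal.ofReal_tsum_of_nonneg (fun i => (hl _).1)
      (Summable.of_nonneg_of_le (fun i => (hl _).1) (fun i => (hl _).2) hs)
  · rw [Measure.ofMeasurable_apply _ hA]
    refine ⟨ENNReal.ofReal_le_ofReal (hl A).2, ?_⟩
    rw [ENNReal.toReal_ofReal (hl A).1]
    exact hlim A

/-- A bounded family of measurable functions has a weak-* limit along every ultrafilter. -/
theorem exists_weak_limit (𝒰 : Ultrafilter α) (ν : Measure Z) [IsFiniteMeasure ν] (B : ℝ)
    (u : α → Z → ℝ) (hu : ∀ F, Measurable (u F)) (h0 : ∀ F z, 0 ≤ u F z)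
    (hB : ∀ F z, u F z ≤ B) :
    ∃ v : Z → ℝ, Measurable v ∧ ∀ m : Measure Z, IsFiniteMeasure m → m ≪ ν → Integrable v m ∧
      Tendsto (fun F => ∫ z, u F z ∂m) 𝒰 (𝓝 (∫ z, v z ∂m)) := by
  obtain ⟨ρ, hρ⟩ := exists_limit_measure 𝒰 ν B u hu h0 hB
  -- A point of Z and an index in α serve only to deduce 0 ≤ B.
  by_cases hZ : Nonempty Z
  swap
  · rw [not_nonempty_iff] at hZ
    refine ⟨fun _ => 0, measurable_const, fun m _ _ => ⟨integrable_zero _ _ _, ?_⟩⟩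
    have hm : m = 0 := Measure.eq_zero_of_isEmpty m
    simp [hm]
  obtain ⟨z₀⟩ := hZ
  have : Nonempty α := by
    by_contra h
    rw [not_nonempty_iff] at h
    exact 𝒰.neBot.ne (Filter.filter_eq_bot_of_isEmpty _)
  obtain ⟨F₀⟩ := this
  have hB0 : 0 ≤ B := (h0 F₀ z₀).trans (hB F₀ z₀)
  have hfin : IsFiniteMeasure ρ := ⟨(hρ _ MeasurableSet.univ).1.trans_lt ENNReal.ofReal_lt_top⟩
  have hac : ρ ≪ ν := by
    refine Measure.AbsolutelyContinuous.mk fun A hA h => ?_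
    have := (hρ A hA).1
    simpa [Measure.real, h] using this
  set v₀ : Z → ℝ := fun z => (ρ.rnDeriv ν z).toReal with hv₀
  have hv₀m : Measurable v₀ := (Measure.measurable_rnDeriv _ _).ennreal_toReal
  have hv₀i : Integrable v₀ ν := Measure.integrable_toReal_rnDeriv
  have hset : ∀ A, MeasurableSet A →
      Tendsto (fun F => ∫ z in A, u F z ∂ν) 𝒰 (𝓝 (∫ z in A, v₀ z ∂ν)) := by
    intro A hA
    have := (hρ A hA).2
    rwa [← Measure.real, ← Measure.setIntegral_toReal_rnDeriv hac A] at this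
  have hv₀B : ∀ᵐ z ∂ν, v₀ z ≤ B := by
    refine ae_le_of_forall_setIntegral_le hv₀i (integrable_const B) fun A hA _ => ?_
    refine le_of_tendsto (hset A hA) (Eventually.of_forall fun F => ?_)
    exact setIntegral_mono (integrable_of_mem_Icc (hu F) (h0 F) (hB F)).integrableOn
      (integrable_const B).integrableOn (hB F)
  -- The density is at most B only almost everywhere; after truncation it is bounded everywhere,
  -- hence integrable for every finite m.
  set v : Z → ℝ := fun z => min (v₀ z) B with hv
  have hvm : Measurable v := hv₀m.min measurable_const
  have hvv : v =ᵐ[ν] v₀ := hv₀B.mono fun z hz => min_eq_left hz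
  have hv0 : ∀ z, 0 ≤ v z := fun z => le_min ENNReal.toReal_nonneg hB0
  have hvB : ∀ z, v z ≤ B := fun z => min_le_right _ _
  refine ⟨v, hvm, fun m hm hmν => ⟨integrable_of_mem_Icc hvm hv0 hvB, ?_⟩⟩
  have hbd : ∀ {x : ℝ} (y : ℝ), 0 ≤ x → x ≤ B → ‖x * y‖ ≤ B * ‖y‖ := fun y hx hxB => by
    rw [norm_mul, Real.norm_of_nonneg hx]
    exact mul_le_mul_of_nonneg_right hxB (norm_nonneg y)
  have hint : ∀ {w : Z → ℝ} {φ : Z → ℝ}, Measurable w → (∀ z, 0 ≤ w z) → (∀ z, w z ≤ B) →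
      Integrable φ ν → Integrable (fun z => w z * φ z) ν := fun hw hw0 hwB hφ =>
    hφ.bdd_mul (c := B) hw.aestronglyMeasurable (Eventually.of_forall fun z => by
      rw [Real.norm_of_nonneg (hw0 z)]; exact hwB z)
  have main : ∀ φ : Z → ℝ, Integrable φ ν →
      Tendsto (fun F => ∫ z, u F z * φ z ∂ν) 𝒰 (𝓝 (∫ z, v z * φ z ∂ν)) := by
    intro φ hφ
    refine Integrable.induction (fun φ => Tendsto (fun F => ∫ z, u F z * φ z ∂ν) 𝒰
      (𝓝 (∫ z, v z * φ z ∂ν))) ?_ ?_ ?_ ?_ hφ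
    · intro c s hs hνs
      have e : ∀ w : Z → ℝ, (∫ z, w z * s.indicator (fun _ => c) z ∂ν)
          = (∫ z in s, w z ∂ν) * c := by
        intro w
        rw [← integral_mul_const, ← integral_indicator hs]
        congr 1
        ext z
        by_cases hz : z ∈ s <;> simp [hz]
      simp only [e]
      have h := (hset s hs).mul_const c
      rwa [show ∫ z in s, v z ∂ν = ∫ z in s, v₀ z ∂ν from
        integral_congr_ae (ae_restrict_of_ae hvv)]
    · intro φ ψ _ hφ hψ h1 h2
      have e : ∀ {w : Z → ℝ}, Measurable w → (∀ z, 0 ≤ w z) → (∀ z, w z ≤ B) → _ :=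
        fun {w} hw hw0 hwB => integral_add (hint hw hw0 hwB hφ) (hint hw hw0 hwB hψ)
      simp only [Pi.add_apply, mul_add]
      rw [e hvm hv0 hvB]
      simp only [e (hu _) (h0 _) (hB _)]
      exact h1.add h2
    · rw [← isSeqClosed_iff_isClosed]
      intro φ ψ hφ hlim
      simp only [Set.mem_ofPred_eq] at hφ ⊢
      rw [Metric.tendsto_nhds]
      intro ε hε
      -- Pairing with a function bounded by B is B-Lipschitz in L¹, uniformly over the family; this
      -- makes the ε/3 argument work.
      have hd : ∀ (n : ℕ) {w : Z → ℝ}, Measurable w → (∀ z, 0 ≤ w z) → (∀ z, w z ≤ B) →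
          |(∫ z, w z * φ n z ∂ν) - ∫ z, w z * ψ z ∂ν| ≤ B * ‖φ n - ψ‖ := by
        intro n w hw hw0 hwB
        rw [← integral_sub (hint hw hw0 hwB (L1.integrable_coeFn _))
          (hint hw hw0 hwB (L1.integrable_coeFn _)), L1.norm_eq_integral_norm,
          ← integral_const_mul, ← Real.norm_eq_abs]
        refine (norm_integral_le_integral_norm _).trans (integral_mono_ae ?_ ?_ ?_)
        · exact ((hint hw hw0 hwB (L1.integrable_coeFn _)).sub
            (hint hw hw0 hwB (L1.integrable_coeFn _))).norm
        · exact (L1.integrable_coeFn _).norm.const_mul B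
        · filter_upwards [Lp.coeFn_sub (φ n) ψ] with z hz
          rw [hz, Pi.sub_apply, ← mul_sub]
          exact hbd _ (hw0 z) (hwB z)
      have hn : Tendsto (fun n => B * ‖φ n - ψ‖) atTop (𝓝 0) := by
        have := (tendsto_iff_norm_sub_tendsto_zero.1 hlim).const_mul B
        simpa using this
      obtain ⟨n, hn⟩ := (hn.eventually (gt_mem_nhds (show (0 : ℝ) < ε / 3 by positivity))).exists
      filter_upwards [Metric.tendsto_nhds.1 (hφ n) (ε / 3) (by positivity)] with F hF
      rw [Real.dist_eq] at hF ⊢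
      have a1 := hd n (hu F) (h0 F) (hB F)
      have a2 := hd n hvm hv0 hvB
      rw [abs_le] at a1 a2
      rw [abs_lt] at hF ⊢
      constructor <;> linarith [a1.1, a1.2, a2.1, a2.2, hF.1, hF.2]
    · intro φ ψ hae _ h
      have e : ∀ w : Z → ℝ, ∫ z, w z * φ z ∂ν = ∫ z, w z * ψ z ∂ν := fun w =>
        integral_congr_ae (hae.mono fun z hz => by simp only [hz])
      simpa only [e] using h
  -- Testing against dm/dν turns integrals over ν into integrals over m, so a single v serves all m
  -- ≪ ν.
  have h := main _ (Measure.integrable_toReal_rnDeriv (μ := m) (ν := ν))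
  have e : ∀ w : Z → ℝ, (∫ z, w z * (m.rnDeriv ν z).toReal ∂ν) = ∫ z, w z ∂m := by
    intro w
    rw [← integral_rnDeriv_smul hmν]
    simp only [smul_eq_mul, mul_comm]
  simpa only [e] using h

end WeakLimit

/-! ### Squared Hellinger distance -/

section Hellinger

variable {Z : Type*} [MeasurableSpace Z]

theorem sq_sqrt_sub_sqrt_le {a b : ℝ} (ha : 0 ≤ a) (hb : 0 ≤ b) : (√a - √b) ^ 2 ≤ a + b := by
  nlinarith [Real.sq_sqrt ha, Real.sq_sqrt hb, Real.sqrt_nonneg a, Real.sqrt_nonneg b,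
    mul_nonneg (Real.sqrt_nonneg a) (Real.sqrt_nonneg b)]

theorem hellingerSq_nonneg (P Q : Measure Z) : 0 ≤ hellingerSq P Q :=
  integral_nonneg fun _ => sq_nonneg _

theorem hellingerSq_le_two (P Q : Measure Z) [IsProbabilityMeasure P] [IsProbabilityMeasure Q] :
    hellingerSq P Q ≤ 2 := by
  have hP : P ≪ P + Q := Measure.AbsolutelyContinuous.rfl.add_right _
  have hQ : Q ≪ P + Q := by rw [add_comm]; exact Measure.AbsolutelyContinuous.rfl.add_right _
  calc hellingerSq P Q
      ≤ ∫ z, ((P.rnDeriv (P + Q) z).toReal + (Q.rnDeriv (P + Q) z).toReal) ∂(P + Q) := by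
        refine integral_mono_of_nonneg (Eventually.of_forall fun _ => sq_nonneg _)
          (Measure.integrable_toReal_rnDeriv.add Measure.integrable_toReal_rnDeriv)
          (Eventually.of_forall fun z => ?_)
        exact sq_sqrt_sub_sqrt_le ENNReal.toReal_nonneg ENNReal.toReal_nonneg
    _ = 2 := by
        rw [integral_add Measure.integrable_toReal_rnDeriv Measure.integrable_toReal_rnDeriv,
          Measure.integral_toReal_rnDeriv hP, Measure.integral_toReal_rnDeriv hQ]
        simp
        norm_num

theorem hellingerSq_self (P : Measure Z) : hellingerSq P P = 0 := by
  simp [hellingerSq]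

/-- The squared Hellinger distance in terms of the density of `P` with respect to `Q`. -/
theorem hellingerSq_eq_of_ac (P Q : Measure Z) [IsFiniteMeasure P] [IsFiniteMeasure Q]
    (h : P ≪ Q) : hellingerSq P Q = ∫ z, (√((P.rnDeriv Q z).toReal) - 1) ^ 2 ∂Q := by
  have hQ : Q ≪ P + Q := by rw [add_comm]; exact Measure.AbsolutelyContinuous.rfl.add_right _
  rw [← integral_rnDeriv_smul hQ, hellingerSq]
  refine integral_congr_ae ?_
  filter_upwards [Measure.rnDeriv_mul_rnDeriv (κ := P + Q) h] with z hz
  rw [← hz, Pi.mul_apply, ENNReal.toReal_mul, Real.sqrt_mul ENNReal.toReal_nonneg, smul_eq_mul]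
  have := Real.sq_sqrt (ENNReal.toReal_nonneg (a := Q.rnDeriv (P + Q) z))
  linear_combination ((√((P.rnDeriv Q z).toReal) - 1) ^ 2) * this

end Hellinger

/-! ### Posterior weights and information gain -/

section Posterior

variable {D Z : Type*} [Fintype D] [MeasurableSpace Z]

theorem mixture_real {ι : Type*} [Fintype ι] {m : ι → ℝ≥0} {N : ι → ProbabilityMeasure Z}
    {Q : Measure Z} (hQ : Q = ∑ a, m a • (N a : Measure Z)) (A : Set Z) :
    Q.real A = ∑ a, (m a : ℝ) * (N a : Measure Z).real A := by
  rw [hQ, measureReal_def, Measure.finsetSum_apply, ENNReal.toReal_sum]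
  · refine Finset.sum_congr rfl fun a _ => ?_
    rw [Measure.smul_apply, ENNReal.smul_def, smul_eq_mul, ENNReal.toReal_mul,
      ENNReal.coe_toReal, measureReal_def]
  · intro a _
    rw [Measure.smul_apply, ENNReal.smul_def, smul_eq_mul]
    exact ENNReal.mul_ne_top ENNReal.coe_ne_top (measure_ne_top _ _)

theorem integral_mixture {ι : Type*} [Fintype ι] {m : ι → ℝ≥0} {N : ι → ProbabilityMeasure Z}
    {Q : Measure Z} (hQ : Q = ∑ a, m a • (N a : Measure Z)) {f : Z → ℝ}
    (hf : ∀ a, Integrable f (N a : Measure Z)) :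
    ∫ z, f z ∂Q = ∑ a, (m a : ℝ) * ∫ z, f z ∂(N a : Measure Z) := by
  rw [hQ, integral_finsetSum_measure fun a _ => (hf a).smul_measure_nnreal]
  exact Finset.sum_congr rfl fun a _ => integral_smul_nnreal_measure _ _

theorem integral_add_const_sub_mul {μ : Measure Z} [IsProbabilityMeasure μ] {f g : Z → ℝ}
    (hf : Integrable f μ) (hg : Integrable g μ) (c d : ℝ) :
    ∫ z, (f z + c - d * g z) ∂μ = ∫ z, f z ∂μ + c - d * ∫ z, g z ∂μ := by
  have hfc : Integrable (fun z => f z + c) μ := hf.add (integrable_const c)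
  rw [integral_sub hfc (hg.const_mul d), integral_add hf (integrable_const c),
    integral_const_mul]
  simp

/-- The densities of the components of a finite mixture sum to one. -/
theorem sum_density_eq_one (m : D → ℝ≥0) (N : D → ProbabilityMeasure Z) (Q : ProbabilityMeasure Z)
    (hQ : (Q : Measure Z) = ∑ a, m a • (N a : Measure Z)) :
    ∀ᵐ z ∂(Q : Measure Z), ∑ a, (m a : ℝ) * ((N a : Measure Z).rnDeriv Q z).toReal = 1 := by
  have hac : ∀ a, m a ≠ 0 → (N a : Measure Z) ≪ Q := by
    intro a ha
    refine Measure.AbsolutelyContinuous.mk fun A _ h => ?_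
    rw [hQ, Measure.finsetSum_apply, Finset.sum_eq_zero_iff] at h
    have := h a (Finset.mem_univ a)
    simpa [ha] using this
  refine ae_eq_of_forall_setIntegral_eq_of_sigmaFinite (μ := (Q : Measure Z)) ?_ ?_ ?_
  · exact fun _ _ _ => (integrable_finsetSum _ fun a _ =>
      (Measure.integrable_toReal_rnDeriv).const_mul _).integrableOn
  · exact fun _ _ _ => (integrable_const _).integrableOn
  · intro A hA _
    rw [integral_finsetSum _ fun a _ =>
      ((Measure.integrable_toReal_rnDeriv).const_mul _).integrableOn]
    have e : ∀ a, ∫ z in A, (m a : ℝ) * ((N a : Measure Z).rnDeriv Q z).toReal ∂(Q : Measure Z)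
        = (m a : ℝ) * (N a : Measure Z).real A := by
      intro a
      by_cases ha : m a = 0
      · simp [ha]
      · rw [integral_const_mul, Measure.setIntegral_toReal_rnDeriv (hac a ha)]
    simp only [e, integral_const, smul_eq_mul, mul_one, measureReal_restrict_apply_univ]
    exact (mixture_real hQ A).symm

/-- A weight vector with `∑ q / w ≤ 1`, in dual form. -/
theorem sq_sum_le_of_sum_div_le {q w : D → ℝ} (hq : ∀ a, 0 ≤ q a) (hw : ∀ a, 0 < w a)
    (h : ∑ a, q a / w a ≤ 1) (s : D → ℝ) :
    (∑ a, s a * √(q a)) ^ 2 ≤ ∑ a, s a ^ 2 * w a := by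
  have h1 := Finset.sum_mul_sq_le_sq_mul_sq Finset.univ (fun a => s a * √(w a))
    (fun a => √(q a / w a))
  have e1 : ∀ a, s a * √(w a) * √(q a / w a) = s a * √(q a) := fun a => by
    rw [mul_assoc, ← Real.sqrt_mul (hw a).le, mul_div_cancel₀ _ (hw a).ne']
  have e2 : ∀ a, (s a * √(w a)) ^ 2 = s a ^ 2 * w a := fun a => by
    rw [mul_pow, Real.sq_sqrt (hw a).le]
  have e3 : ∀ a, √(q a / w a) ^ 2 = q a / w a := fun a =>
    Real.sq_sqrt (div_nonneg (hq a) (hw a).le)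
  simp only [e1, e2, e3] at h1
  have h0 : 0 ≤ ∑ a, s a ^ 2 * w a :=
    Finset.sum_nonneg fun a _ => mul_nonneg (sq_nonneg _) (hw a).le
  nlinarith

/-- Weights built from the posterior distribution: they lose at most the information gain,
measured in Hellinger distance. -/
theorem exists_posterior_weights (m : D → ℝ≥0) (N : D → ProbabilityMeasure Z)
    (Q : ProbabilityMeasure Z) (hm : ∑ a, m a = 1)
    (hQ : (Q : Measure Z) = ∑ a, m a • (N a : Measure Z))
    (q : D → ℝ) (hq : ∀ a, 0 < q a) (hq1 : ∑ a, q a = 1) (κ : ℝ) (hκ : 0 < κ) (hκ1 : κ ≤ 1) :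
    ∃ w : D → Z → ℝ, (∀ a, Measurable (w a)) ∧
      (∀ a z, 0 ≤ w a z ∧ w a z ≤ (Fintype.card D + 1) / κ) ∧
      (∀ z (s : D → ℝ), (∑ a, s a * √(q a)) ^ 2 ≤ ∑ a, s a ^ 2 * w a z) ∧
      ∑ a, (m a : ℝ) * ∫ z, w a z ∂(N a : Measure Z)
        ≤ 1 + κ - 1 / 8 * ∑ a, (m a : ℝ) * hellingerSq (N a : Measure Z) Q := by
  have hac : ∀ a, m a ≠ 0 → (N a : Measure Z) ≪ Q := by
    intro a ha
    refine Measure.AbsolutelyContinuous.mk fun A _ h => ?_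
    rw [hQ, Measure.finsetSum_apply, Finset.sum_eq_zero_iff] at h
    have := h a (Finset.mem_univ a)
    simpa [ha] using this
  have hm1 : ∑ a, (m a : ℝ) = 1 := by exact_mod_cast hm
  have hqle : ∀ a, q a ≤ 1 := fun a => by
    rw [← hq1]; exact Finset.single_le_sum (fun b _ => (hq b).le) (Finset.mem_univ a)
  set n : D → Z → ℝ := fun a z => ((N a : Measure Z).rnDeriv Q z).toReal with hn
  have hnm : ∀ a, Measurable (n a) := fun a => (Measure.measurable_rnDeriv _ _).ennreal_toReal
  have hn0 : ∀ a z, 0 ≤ n a z := fun a z => ENNReal.toReal_nonneg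
  -- The posterior probability of a given z. The truncation is void Q-almost everywhere but gives
  -- bounds at every z.
  set ρ : D → Z → ℝ := fun a z => min ((m a : ℝ) * n a z) 1 with hρ
  have hρm : ∀ a, Measurable (ρ a) := fun a => ((hnm a).const_mul _).min measurable_const
  have hρ0 : ∀ a z, 0 ≤ ρ a z := fun a z =>
    le_min (mul_nonneg (m a).2 (hn0 a z)) zero_le_one
  have hρ1 : ∀ a z, ρ a z ≤ 1 := fun a z => min_le_right _ _
  -- The ideal weight is proportional to 1/√(ρ/q); the summand κ keeps it bounded.
  set e : D → Z → ℝ := fun a z => √(ρ a z / q a) + κ with he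
  have he0 : ∀ a z, κ ≤ e a z := fun a z => le_add_of_nonneg_left (Real.sqrt_nonneg _)
  have hepos : ∀ a z, 0 < e a z := fun a z => hκ.trans_le (he0 a z)
  have hem : ∀ a, Measurable (e a) := fun a => ((hρm a).div_const _).sqrt.add_const _
  set S₀ : Z → ℝ := fun z => ∑ a, √(q a) * √(ρ a z) with hS₀
  have hS₀0 : ∀ z, 0 ≤ S₀ z := fun z => Finset.sum_nonneg fun a _ => by positivity
  have hsq : ∀ a z, q a * √(ρ a z / q a) = √(q a) * √(ρ a z) := by
    intro a z
    rw [Real.sqrt_div' _ (hq a).le]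
    have h1 := Real.sq_sqrt (hq a).le
    have h2 : √(q a) ≠ 0 := (Real.sqrt_pos.2 (hq a)).ne'
    field_simp
    rw [h1, mul_comm]
  have hS : ∀ z, ∑ a, q a * e a z = S₀ z + κ := by
    intro z
    simp only [he, mul_add, hsq, Finset.sum_add_distrib, ← Finset.sum_mul, hq1, one_mul, hS₀]
  have hSm : Measurable S₀ :=
    Finset.measurable_fun_sum _ fun a _ => (hρm a).sqrt.const_mul _
  have hScard : ∀ z, S₀ z ≤ Fintype.card D := by
    intro z
    calc S₀ z ≤ ∑ _ : D, (1 : ℝ) := Finset.sum_le_sum fun a _ => by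
          have h1 : √(q a) ≤ 1 := Real.sqrt_le_one.2 (hqle a)
          have h2 : √(ρ a z) ≤ 1 := Real.sqrt_le_one.2 (hρ1 a z)
          exact mul_le_one₀ h1 (Real.sqrt_nonneg _) h2
      _ = Fintype.card D := by simp
  -- The numerator equals ∑ q e, so that ∑ q / w = 1 exactly.
  set w : D → Z → ℝ := fun a z => (S₀ z + κ) / e a z with hw
  have hwm : ∀ a, Measurable (w a) := fun a => (hSm.add_const _).div (hem a)
  have hwpos : ∀ a z, 0 < w a z := fun a z => div_pos (by linarith [hS₀0 z]) (hepos a z)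
  have hwB : ∀ a z, w a z ≤ (Fintype.card D + 1) / κ := fun a z =>
    div_le_div₀ (by positivity) (by linarith [hScard z]) hκ (he0 a z)
  refine ⟨w, hwm, fun a z => ⟨(hwpos a z).le, hwB a z⟩, fun z s => ?_, ?_⟩
  · refine sq_sum_le_of_sum_div_le (fun a => (hq a).le) (fun a => hwpos a z) ?_ s
    have : ∀ a, q a / w a z = q a * e a z / (S₀ z + κ) := fun a => by
      simp only [hw, div_div_eq_mul_div]
    simp only [this, ← Finset.sum_div, hS]
    exact (div_self (by linarith [hS₀0 z])).le
  · have hae : ∀ᵐ z ∂(Q : Measure Z), (∀ a, ρ a z = m a * n a z) ∧ ∑ a, ρ a z = 1 := by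
      filter_upwards [sum_density_eq_one m N Q hQ] with z hz
      have : ∀ a, ρ a z = m a * n a z := fun a => min_eq_left (by
        rw [← hz]
        exact Finset.single_le_sum (f := fun a => (m a : ℝ) * n a z)
          (fun b _ => mul_nonneg (m b).2 (hn0 b z)) (Finset.mem_univ a))
      exact ⟨this, by simp only [this]; exact hz⟩
    set x : D → ℝ := fun a => ∫ z, √(ρ a z) ∂(Q : Measure Z) with hx
    have hsi : ∀ a, Integrable (fun z => √(ρ a z)) (Q : Measure Z) := fun a =>
      integrable_of_mem_Icc (hρm a).sqrt (fun z => Real.sqrt_nonneg _)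
        (fun z => Real.sqrt_le_one.2 (hρ1 a z))
    have hx0 : ∀ a, 0 ≤ x a := fun a => integral_nonneg fun z => Real.sqrt_nonneg _
    have hρi : ∀ a, Integrable (ρ a) (Q : Measure Z) := fun a =>
      integrable_of_mem_Icc (hρm a) (hρ0 a) (hρ1 a)
    have hint : ∀ a, ∫ z, ρ a z ∂(Q : Measure Z) = m a := by
      intro a
      rw [integral_congr_ae (hae.mono fun z hz => hz.1 a), integral_const_mul]
      by_cases ha : m a = 0
      · simp [ha]
      · rw [Measure.integral_toReal_rnDeriv (hac a ha)]; simp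
    have hhell : ∀ a, (m a : ℝ) * hellingerSq (N a : Measure Z) Q
        = 2 * m a - 2 * √(m a : ℝ) * x a := by
      intro a
      by_cases ha : m a = 0
      · simp [ha]
      have e1 : (m a : ℝ) * hellingerSq (N a : Measure Z) Q
          = ∫ z, (ρ a z + m a - 2 * √(m a : ℝ) * √(ρ a z)) ∂(Q : Measure Z) := by
        rw [hellingerSq_eq_of_ac _ _ (hac a ha), ← integral_const_mul]
        refine integral_congr_ae (hae.mono fun z hz => ?_)
        simp only
        rw [hz.1 a, Real.sqrt_mul (NNReal.coe_nonneg _)]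
        have h1 := Real.sq_sqrt (NNReal.coe_nonneg (m a))
        have h2 := Real.sq_sqrt (hn0 a z)
        simp only [hn] at h1 h2 ⊢
        linear_combination (m a : ℝ) * h2 + 2 * √(((N a : Measure Z).rnDeriv Q z).toReal) * h1
      rw [e1, integral_add_const_sub_mul (hρi a) (hsi a), hint]
      ring
    have hxm : ∀ a, x a ≤ √(m a : ℝ) := by
      intro a
      have h0 : 0 ≤ ∫ z, (√(ρ a z) - x a) ^ 2 ∂(Q : Measure Z) :=
        integral_nonneg fun z => sq_nonneg _
      have e1 : ∀ z, (√(ρ a z) - x a) ^ 2 = ρ a z + x a ^ 2 - 2 * x a * √(ρ a z) := fun z => by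
        have := Real.sq_sqrt (hρ0 a z)
        linear_combination this
      simp only [e1] at h0
      rw [integral_add_const_sub_mul (hρi a) (hsi a), hint] at h0
      change 0 ≤ (m a : ℝ) + x a ^ 2 - 2 * x a * x a at h0
      exact Real.le_sqrt_of_sq_le (by nlinarith)
    have hwi : ∀ a, (m a : ℝ) * ∫ z, w a z ∂(N a : Measure Z)
        = ∫ z, ρ a z * w a z ∂(Q : Measure Z) := by
      intro a
      by_cases ha : m a = 0
      · rw [ha, integral_congr_ae (g := fun _ => 0) (hae.mono fun z hz => by
          simp only [hz.1 a, ha]; simp)]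
        simp
      · rw [← integral_rnDeriv_smul (hac a ha), ← integral_const_mul]
        refine integral_congr_ae (hae.mono fun z hz => ?_)
        simp only [hz.1 a, smul_eq_mul, hn]
        ring
    have hρwi : ∀ a, Integrable (fun z => ρ a z * w a z) (Q : Measure Z) := fun a =>
      integrable_of_mem_Icc ((hρm a).mul (hwm a))
        (fun z => mul_nonneg (hρ0 a z) (hwpos a z).le)
        (B := 1 * ((Fintype.card D + 1) / κ))
        (fun z => mul_le_mul (hρ1 a z) (hwB a z) (hwpos a z).le zero_le_one)
    -- Each term is at most (S₀ + κ) √(q ρ), which sums to (S₀ + κ) S₀, and S₀ ≤ 1 by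
    -- Cauchy–Schwarz.
    have hpt : ∀ᵐ z ∂(Q : Measure Z), ∑ a, ρ a z * w a z ≤ S₀ z + κ := by
      filter_upwards [hae] with z hz
      have hS1 : S₀ z ≤ 1 := by
        have := Finset.sum_mul_sq_le_sq_mul_sq Finset.univ (fun a => √(q a)) (fun a => √(ρ a z))
        simp only [Real.sq_sqrt (hq _).le, Real.sq_sqrt (hρ0 _ z), hq1, hz.2, mul_one] at this
        exact (sq_le_one_iff₀ (hS₀0 z)).1 this
      have h1 : ∀ a, ρ a z * w a z ≤ (S₀ z + κ) * (√(q a) * √(ρ a z)) := by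
        intro a
        have : ρ a z = √(ρ a z / q a) * (√(q a) * √(ρ a z)) := by
          rw [← mul_assoc, ← Real.sqrt_mul' _ (hq a).le, div_mul_cancel₀ _ (hq a).ne',
            Real.mul_self_sqrt (hρ0 a z)]
        have h2 : √(ρ a z / q a) / e a z ≤ 1 :=
          (div_le_one (hepos a z)).2 (le_add_of_nonneg_right hκ.le)
        calc ρ a z * w a z
            = (√(ρ a z / q a) / e a z) * ((S₀ z + κ) * (√(q a) * √(ρ a z))) := by
              simp only [hw]
              conv_lhs => rw [this]
              ring
          _ ≤ 1 * ((S₀ z + κ) * (√(q a) * √(ρ a z))) :=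
              mul_le_mul_of_nonneg_right h2
                (mul_nonneg (by linarith [hS₀0 z]) (by positivity))
          _ = _ := one_mul _
      calc ∑ a, ρ a z * w a z ≤ ∑ a, (S₀ z + κ) * (√(q a) * √(ρ a z)) :=
            Finset.sum_le_sum fun a _ => h1 a
        _ = (S₀ z + κ) * S₀ z := by rw [← Finset.mul_sum]
        _ ≤ S₀ z + κ := by nlinarith [hS₀0 z]
    have hSi : Integrable S₀ (Q : Measure Z) := integrable_of_mem_Icc hSm hS₀0 hScard
    have htot : ∑ a, (m a : ℝ) * ∫ z, w a z ∂(N a : Measure Z) ≤ ∑ a, √(q a) * x a + κ := by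
      simp only [hwi]
      rw [← integral_finsetSum _ fun a _ => hρwi a]
      calc ∫ z, ∑ a, ρ a z * w a z ∂(Q : Measure Z) ≤ ∫ z, (S₀ z + κ) ∂(Q : Measure Z) :=
            integral_mono_ae (integrable_finsetSum _ fun a _ => hρwi a)
              (hSi.add (integrable_const _)) hpt
        _ = ∑ a, √(q a) * x a + κ := by
            rw [integral_add hSi (integrable_const _),
              integral_finsetSum _ fun a _ => (hsi a).const_mul _]
            simp [integral_const_mul, hx]
    refine htot.trans ?_
    -- The left side is 2√m(√m - x). Since m + q - 2√q x = (√q - x)² + m - x² and 0 ≤ x ≤ √m, the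
    -- right side is at least 4√m(√m - x). Summing gives ∑ m D_H² ≤ 8(1 - ∑ √q x), the source of the
    -- constant 1/8.
    have hterm : ∀ a, (m a : ℝ) * hellingerSq (N a : Measure Z) Q
        ≤ 4 * (m a + q a - 2 * (√(q a) * x a)) := by
      intro a
      rw [hhell]
      have h1 := Real.sq_sqrt (m a).2
      have h2 := Real.sq_sqrt (hq a).le
      simp only [NNReal.val_eq_coe] at h1
      have h3 := hxm a
      have h4 := hx0 a
      nlinarith [sq_nonneg (√(q a) - x a), mul_nonneg h4 (sub_nonneg.2 h3),
        mul_nonneg (Real.sqrt_nonneg (m a : ℝ)) (sub_nonneg.2 h3)]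
    have hsum := Finset.sum_le_sum fun a (_ : a ∈ Finset.univ) => hterm a
    rw [← Finset.mul_sum, Finset.sum_sub_distrib, Finset.sum_add_distrib, hm1, hq1,
      ← Finset.mul_sum] at hsum
    linarith

end Posterior

/-! ### Finite mixtures of models -/

section Mixtures

variable {D Z : Type*} [MeasurableSpace Z] {𝓜 : Set (Model D Z)}

theorem exists_mixture {ι : Type*} [Fintype ι] (w : ι → ℝ≥0) (hw : ∑ i, w i = 1)
    (M : ι → Model D Z) :
    ∃ N : Model D Z, ∀ π, (N π : Measure Z) = ∑ i, w i • (M i π : Measure Z) := by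
  refine ⟨fun π => ⟨∑ i, w i • (M i π : Measure Z), ⟨?_⟩⟩, fun π => rfl⟩
  rw [Measure.finsetSum_apply]
  simp only [Measure.smul_apply, measure_univ, ENNReal.smul_def, smul_eq_mul, mul_one]
  exact_mod_cast hw

theorem mem_co_of_mixture {ι : Type*} [Fintype ι] (w : ι → ℝ≥0) (hw : ∑ i, w i = 1)
    (M : ι → Model D Z) (hM : ∀ i, M i ∈ 𝓜) (N : Model D Z)
    (hN : ∀ π, (N π : Measure Z) = ∑ i, w i • (M i π : Measure Z)) : N ∈ co 𝓜 := by
  let e := (Fintype.equivFin ι).symm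
  refine ⟨Fintype.card ι, w ∘ e, M ∘ e, ?_, fun i => hM _, fun π => ?_⟩
  · rw [← hw]; exact e.sum_comp w
  · rw [hN]; exact (e.sum_comp fun i => w i • (M i π : Measure Z)).symm

theorem subset_co : 𝓜 ⊆ co 𝓜 := fun M hM =>
  mem_co_of_mixture (ι := Unit) (fun _ => 1) (by simp) (fun _ => M) (fun _ => hM) M (by simp)

/-- The convex hull is closed under finite mixtures. -/
theorem mem_co_of_mixture_co {ι : Type*} [Fintype ι] (w : ι → ℝ≥0) (hw : ∑ i, w i = 1)
    (M : ι → Model D Z) (hM : ∀ i, M i ∈ co 𝓜) (N : Model D Z)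
    (hN : ∀ π, (N π : Measure Z) = ∑ i, w i • (M i π : Measure Z)) : N ∈ co 𝓜 := by
  choose n w' M' hw' hM' hMM' using hM
  refine mem_co_of_mixture (ι := Σ i, Fin (n i)) (fun x => w x.1 * w' x.1 x.2) ?_
    (fun x => M' x.1 x.2) (fun x => hM' _ _) N fun π => ?_
  · rw [Fintype.sum_sigma]
    simp only [← Finset.mul_sum, hw', mul_one, hw]
  · rw [hN, Fintype.sum_sigma]
    refine Finset.sum_congr rfl fun i _ => ?_
    rw [hMM', Finset.smul_sum]
    simp only [smul_smul]

end Mixtures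

/-! ### Elementary bounds for the decision-estimation coefficient -/

section Dec

variable {D Z : Type*} [MeasurableSpace Z] {r : Z → ℝ}

theorem integrable_reward (hr : Measurable r) (hr1 : ∀ z, r z ∈ Set.Icc (0 : ℝ) 1)
    (P : Measure Z) [IsFiniteMeasure P] : Integrable r P :=
  integrable_of_mem_Icc hr (fun z => (hr1 z).1) (fun z => (hr1 z).2)

theorem meanReward_mem_Icc (hr : Measurable r) (hr1 : ∀ z, r z ∈ Set.Icc (0 : ℝ) 1)
    (M : Model D Z) (π : D) : meanReward r M π ∈ Set.Icc (0 : ℝ) 1 := by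
  refine ⟨integral_nonneg fun z => (hr1 z).1, ?_⟩
  have := integral_le_mul_real (m := (M π : Measure Z)) hr (fun z => (hr1 z).1)
    (fun z => (hr1 z).2)
  rwa [probReal_univ, mul_one] at this

variable [Fintype D]

/-- The expected regret of `p` under `M`, offset by the information gained relative to `Mbar`. -/
def decPayoff (r : Z → ℝ) (γ : ℝ) (p : D → ℝ) (M Mbar : Model D Z) : ℝ :=
  ∑ π, p π * ((⨆ π', meanReward r M π') - meanReward r M π
      - γ * hellingerSq (M π : Measure Z) (Mbar π : Measure Z))

theorem meanReward_le_iSup (M : Model D Z) (π : D) :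
    meanReward r M π ≤ ⨆ π', meanReward r M π' :=
  le_ciSup (Set.finite_range _).bddAbove π

theorem decPayoff_le_one (hr : Measurable r) (hr1 : ∀ z, r z ∈ Set.Icc (0 : ℝ) 1) {γ : ℝ}
    (hγ : 0 ≤ γ) {p : D → ℝ} (hp : p ∈ stdSimplex ℝ D) (M Mbar : Model D Z) :
    decPayoff r γ p M Mbar ≤ 1 := by
  calc decPayoff r γ p M Mbar ≤ ∑ π, p π * 1 := by
        refine Finset.sum_le_sum fun π _ => mul_le_mul_of_nonneg_left ?_ (hp.1 π)
        have : Nonempty D := ⟨π⟩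
        have h1 : (⨆ π', meanReward r M π') ≤ 1 :=
          ciSup_le fun π' => (meanReward_mem_Icc hr hr1 M π').2
        have h2 := (meanReward_mem_Icc hr hr1 M π).1
        have h3 := mul_nonneg hγ (hellingerSq_nonneg (M π : Measure Z) (Mbar π : Measure Z))
        linarith
    _ = 1 := by simp [hp.2]

/-- The squared Hellinger distance never exceeds 2, so for small γ the penalty is negligible. This
extracts a no-regret distribution when the tradeoff vanishes. -/
theorem decPayoff_ge {γ : ℝ} (hγ : 0 ≤ γ) {p : D → ℝ} (hp : p ∈ stdSimplex ℝ D)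
    (M Mbar : Model D Z) :
    ∑ π, p π * ((⨆ π', meanReward r M π') - meanReward r M π) - 2 * γ
      ≤ decPayoff r γ p M Mbar := by
  have : ∑ π, p π * ((⨆ π', meanReward r M π') - meanReward r M π) - 2 * γ
      = ∑ π, p π * ((⨆ π', meanReward r M π') - meanReward r M π - γ * 2) := by
    simp only [mul_sub, Finset.sum_sub_distrib, ← Finset.sum_mul, hp.2]
    ring
  rw [this]
  refine Finset.sum_le_sum fun π _ => mul_le_mul_of_nonneg_left ?_ (hp.1 π)
  have := mul_le_mul_of_nonneg_left (hellingerSq_le_two (M π : Measure Z) (Mbar π)) hγ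
  linarith

theorem regret_nonneg {p : D → ℝ} (hp : p ∈ stdSimplex ℝ D) (M : Model D Z) :
    0 ≤ ∑ π, p π * ((⨆ π', meanReward r M π') - meanReward r M π) :=
  Finset.sum_nonneg fun π _ => mul_nonneg (hp.1 π) (sub_nonneg.2 (meanReward_le_iSup M π))

theorem bddAbove_decPayoff (hr : Measurable r) (hr1 : ∀ z, r z ∈ Set.Icc (0 : ℝ) 1) {γ : ℝ}
    (hγ : 0 ≤ γ) {p : D → ℝ} (hp : p ∈ stdSimplex ℝ D) (𝓚 : Set (Model D Z)) (Mbar : Model D Z) :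
    BddAbove (Set.range fun M : 𝓚 => decPayoff r γ p M.1 Mbar) :=
  ⟨1, by rintro _ ⟨M, rfl⟩; exact decPayoff_le_one hr hr1 hγ hp _ _⟩

/-- The choice M = Mbar kills the penalty and leaves a nonnegative regret; this is why the reference
model must lie in the class. -/
theorem iSup_decPayoff_nonneg (hr : Measurable r) (hr1 : ∀ z, r z ∈ Set.Icc (0 : ℝ) 1) {γ : ℝ}
    (hγ : 0 ≤ γ) {p : D → ℝ} (hp : p ∈ stdSimplex ℝ D) {𝓚 : Set (Model D Z)} {Mbar : Model D Z}
    (hM : Mbar ∈ 𝓚) : 0 ≤ ⨆ M : 𝓚, decPayoff r γ p M.1 Mbar := by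
  refine le_trans ?_ (le_ciSup (bddAbove_decPayoff hr hr1 hγ hp 𝓚 Mbar) ⟨Mbar, hM⟩)
  have := regret_nonneg (r := r) hp Mbar
  simpa [decPayoff, hellingerSq_self] using this

theorem bddBelow_iSup_decPayoff (hr : Measurable r) (hr1 : ∀ z, r z ∈ Set.Icc (0 : ℝ) 1) {γ : ℝ}
    (hγ : 0 ≤ γ) {𝓚 : Set (Model D Z)} {Mbar : Model D Z} (hM : Mbar ∈ 𝓚) :
    BddBelow (Set.range fun p : stdSimplex ℝ D => ⨆ M : 𝓚, decPayoff r γ p.1 M.1 Mbar) :=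
  ⟨0, by rintro _ ⟨p, rfl⟩; exact iSup_decPayoff_nonneg hr hr1 hγ p.2 hM⟩

variable [Nonempty D]

instance nonempty_stdSimplex : Nonempty (stdSimplex ℝ D) := by
  classical
  exact ⟨⟨_, single_mem_stdSimplex ℝ (Classical.arbitrary D)⟩⟩

theorem decAt_nonneg (hr : Measurable r) (hr1 : ∀ z, r z ∈ Set.Icc (0 : ℝ) 1) {γ : ℝ}
    (hγ : 0 ≤ γ) {𝓚 : Set (Model D Z)} {Mbar : Model D Z} (hM : Mbar ∈ 𝓚) :
    0 ≤ decAt r γ 𝓚 Mbar :=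
  le_ciInf fun p => iSup_decPayoff_nonneg hr hr1 hγ p.2 hM

theorem decAt_le_one (hr : Measurable r) (hr1 : ∀ z, r z ∈ Set.Icc (0 : ℝ) 1) {γ : ℝ}
    (hγ : 0 ≤ γ) {𝓚 : Set (Model D Z)} {Mbar : Model D Z} (hM : Mbar ∈ 𝓚) :
    decAt r γ 𝓚 Mbar ≤ 1 := by
  have p : stdSimplex ℝ D := Classical.arbitrary _
  have : Nonempty 𝓚 := ⟨⟨Mbar, hM⟩⟩
  exact (ciInf_le (bddBelow_iSup_decPayoff hr hr1 hγ hM) p).trans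
    (ciSup_le fun M => decPayoff_le_one hr hr1 hγ p.2 _ _)

theorem decAt_le_dec (hr : Measurable r) (hr1 : ∀ z, r z ∈ Set.Icc (0 : ℝ) 1) {γ : ℝ}
    (hγ : 0 ≤ γ) {𝓚 : Set (Model D Z)} {Mbar : Model D Z} (hM : Mbar ∈ 𝓚) :
    decAt r γ 𝓚 Mbar ≤ dec r γ 𝓚 :=
  le_ciSup (f := fun Mbar : 𝓚 => decAt r γ 𝓚 Mbar.1)
    ⟨1, by rintro _ ⟨M, rfl⟩; exact decAt_le_one hr hr1 hγ M.2⟩ ⟨Mbar, hM⟩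

theorem dec_nonneg (hr : Measurable r) (hr1 : ∀ z, r z ∈ Set.Icc (0 : ℝ) 1) {γ : ℝ}
    (hγ : 0 ≤ γ) (𝓚 : Set (Model D Z)) : 0 ≤ dec r γ 𝓚 :=
  Real.iSup_nonneg fun M => decAt_nonneg hr hr1 hγ M.2

theorem dec_le_one (hr : Measurable r) (hr1 : ∀ z, r z ∈ Set.Icc (0 : ℝ) 1) {γ : ℝ}
    (hγ : 0 ≤ γ) (𝓚 : Set (Model D Z)) : dec r γ 𝓚 ≤ 1 :=
  Real.iSup_le (fun M => decAt_le_one hr hr1 hγ M.2) zero_le_one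

theorem exists_decPayoff_le (hr : Measurable r) (hr1 : ∀ z, r z ∈ Set.Icc (0 : ℝ) 1) {γ : ℝ}
    (hγ : 0 ≤ γ) {𝓚 : Set (Model D Z)} {Mbar : Model D Z} (hM : Mbar ∈ 𝓚) {ε : ℝ} (hε : 0 < ε) :
    ∃ p ∈ stdSimplex ℝ D, ∀ M ∈ 𝓚, decPayoff r γ p M Mbar ≤ dec r γ 𝓚 + ε := by
  have h : decAt r γ 𝓚 Mbar < dec r γ 𝓚 + ε :=
    (decAt_le_dec hr hr1 hγ hM).trans_lt (lt_add_of_pos_right _ hε)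
  obtain ⟨p, hp⟩ := exists_lt_of_ciInf_lt h
  exact ⟨p.1, p.2, fun M hM' =>
    (le_ciSup (bddAbove_decPayoff hr hr1 hγ p.2 𝓚 Mbar) ⟨M, hM'⟩).trans hp.le⟩

end Dec

/-! ### The linearized problem and its Bayesian solution -/

section Strategies

variable {D Z : Type*} [MeasurableSpace Z] [Fintype D]

/-- A sampling distribution `p` with a weight function `u a π z`, which stands for
`p(π) ∑ π', q(π') exp(η / p(π) (g(π'; π, z) - g(a; π, z)))`. -/
structure Admissible (q : D → ℝ) (B : ℝ) (p : D → ℝ) (u : D → D → Z → ℝ) : Prop where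
  mem : p ∈ stdSimplex ℝ D
  meas : ∀ a π, Measurable (u a π)
  nonneg : ∀ a π z, 0 ≤ u a π z
  le : ∀ a π z, u a π z ≤ p π * B
  -- For p π > 0 and q > 0 this says p π * ∑ q / u ≤ 1. In this form each s gives an inequality
  -- linear in (p, u), which survives convex combinations, weak limits and averaging over kernels.
  dual : ∀ π z (s : D → ℝ), p π * (∑ a, s a * √(q a)) ^ 2 ≤ ∑ a, s a ^ 2 * u a π z

/-- The objective as a linear function of `p` and `u`. -/
def linObj (r : Z → ℝ) (η : ℝ) (p : D → ℝ) (u : D → D → Z → ℝ) (M : Model D Z) (a : D) : ℝ :=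
  ∑ π, p π * (meanReward r M a - meanReward r M π)
    + 1 / η * (∑ π, ∫ z, u a π z ∂(M π : Measure Z) - 1)

theorem Admissible.integrable {q : D → ℝ} {B : ℝ} {p : D → ℝ} {u : D → D → Z → ℝ}
    (h : Admissible q B p u) (a π : D) (P : Measure Z) [IsFiniteMeasure P] :
    Integrable (u a π) P :=
  integrable_of_mem_Icc (h.meas a π) (h.nonneg a π) (h.le a π)

/-- Conditioning a finite mixture of pairs `(M, a)` on the second component. -/
theorem exists_conditional_mixture {ι : Type*} [Fintype ι] (μ : ι → ℝ≥0) (hμ : ∑ i, μ i = 1)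
    (M : ι → Model D Z) (b : ι → D) {𝓜 : Set (Model D Z)} (hM : ∀ i, M i ∈ co 𝓜) :
    ∃ (m : D → ℝ≥0) (N : D → Model D Z) (Q : Model D Z), ∑ a, m a = 1 ∧ (∀ a, N a ∈ co 𝓜) ∧
      Q ∈ co 𝓜 ∧ (∀ π, (Q π : Measure Z) = ∑ a, m a • (N a π : Measure Z)) ∧
      ∀ (φ : D → D → Z → ℝ) (π : D → D),
        (∀ a π (P : ProbabilityMeasure Z), Integrable (φ a π) (P : Measure Z)) →
        ∑ a, (m a : ℝ) * ∫ z, φ a (π a) z ∂(N a (π a) : Measure Z)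
          = ∑ i, (μ i : ℝ) * ∫ z, φ (b i) (π (b i)) z ∂(M i (π (b i)) : Measure Z) := by
  classical
  obtain ⟨i₀⟩ : Nonempty ι := by
    by_contra h
    rw [not_nonempty_iff] at h
    simp at hμ
  set c : D → ι → ℝ≥0 := fun a i => if b i = a then μ i else 0 with hc
  set m : D → ℝ≥0 := fun a => ∑ i, c a i with hm
  have hcs : ∀ i, ∑ a, c a i = μ i := fun i => by simp [hc]
  have hm1 : ∑ a, m a = 1 := by
    simp only [hm]; rw [Finset.sum_comm]; simp only [hcs, hμ]
  have hex : ∀ a, ∃ N ∈ co 𝓜, ∀ π, m a • (N π : Measure Z) = ∑ i, c a i • (M i π : Measure Z) := by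
    intro a
    -- Conditioning on an event of weight zero: any member of the hull will do.
    by_cases ha : m a = 0
    · refine ⟨M i₀, hM i₀, fun π => ?_⟩
      have : ∀ i, c a i = 0 := fun i => (Finset.sum_eq_zero_iff.1 ha) i (Finset.mem_univ i)
      simp [this, ha]
    · have h1 : ∑ i, c a i / m a = 1 := by rw [← Finset.sum_div]; exact div_self ha
      obtain ⟨N, hN⟩ := exists_mixture (fun i => c a i / m a) h1 M
      refine ⟨N, mem_co_of_mixture_co _ h1 M hM N hN, fun π => ?_⟩
      rw [hN, Finset.smul_sum]
      refine Finset.sum_congr rfl fun i _ => ?_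
      rw [smul_smul, mul_div_cancel₀ _ ha]
  choose N hN hNm using hex
  obtain ⟨Q, hQ⟩ := exists_mixture m hm1 N
  refine ⟨m, N, Q, hm1, hN, mem_co_of_mixture_co m hm1 N hN Q hQ, hQ, fun φ π hφ => ?_⟩
  have h1 : ∀ a, (m a : ℝ) * ∫ z, φ a (π a) z ∂(N a (π a) : Measure Z)
      = ∑ i, (c a i : ℝ) * ∫ z, φ a (π a) z ∂(M i (π a) : Measure Z) := by
    intro a
    rw [← integral_mixture (hNm a (π a)) fun i => hφ a (π a) _, integral_smul_nnreal_measure]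
    rfl
  simp only [h1]
  rw [Finset.sum_comm]
  refine Finset.sum_congr rfl fun i _ => ?_
  simp [hc, apply_ite, ite_mul]

variable [Nonempty D] {r : Z → ℝ}

/-- Against a known finite mixture of pairs `(M, a)` the learner achieves the decision-estimation
coefficient of the convex hull. -/
theorem exists_admissible_of_mixture (hr : Measurable r) (hr1 : ∀ z, r z ∈ Set.Icc (0 : ℝ) 1)
    {η κ : ℝ} (hη : 0 < η) (hκ : 0 < κ) (hκ1 : κ ≤ 1) {q : D → ℝ} (hq : ∀ a, 0 < q a)
    (hq1 : ∑ a, q a = 1) {ι : Type*} [Fintype ι] (μ : ι → ℝ≥0) (hμ : ∑ i, μ i = 1)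
    (M : ι → Model D Z) (b : ι → D) {𝓜 : Set (Model D Z)} (hM : ∀ i, M i ∈ co 𝓜) :
    ∃ p u, Admissible q ((Fintype.card D + 1) / κ) p u ∧
      ∑ i, (μ i : ℝ) * linObj r η p u (M i) (b i)
        ≤ dec r (1 / (8 * η)) (co 𝓜) + (κ + κ / η) := by
  obtain ⟨m, N, Q, hm1, hN, hQ, hQm, hre⟩ := exists_conditional_mixture μ hμ M b hM
  -- The reference model is the total mixture Q. The error κ arises here; the error κ / η comes from
  -- the regularized posterior weights.
  obtain ⟨p, hp, hpd⟩ := exists_decPayoff_le hr hr1 (show 0 ≤ 1 / (8 * η) by positivity) hQ hκ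
  choose w hwm hwB hwd hwo using fun π =>
    exists_posterior_weights m (fun a => N a π) (Q π) hm1 (hQm π) q hq hq1 κ hκ hκ1
  have hm1' : ∑ a, (m a : ℝ) = 1 := by exact_mod_cast hm1
  have hμ' : ∑ i, (μ i : ℝ) = 1 := by exact_mod_cast hμ
  refine ⟨p, fun a π z => p π * w π a z, ⟨hp, fun a π => (hwm π a).const_mul _,
    fun a π z => mul_nonneg (hp.1 π) (hwB π a z).1,
    fun a π z => mul_le_mul_of_nonneg_left (hwB π a z).2 (hp.1 π), fun π z s => ?_⟩, ?_⟩
  · calc p π * (∑ a, s a * √(q a)) ^ 2 ≤ p π * ∑ a, s a ^ 2 * w π a z :=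
          mul_le_mul_of_nonneg_left (hwd π z s) (hp.1 π)
      _ = _ := by rw [Finset.mul_sum]; exact Finset.sum_congr rfl fun a _ => by ring
  · have hwi : ∀ a π (P : ProbabilityMeasure Z), Integrable (w π a) (P : Measure Z) :=
      fun a π P => integrable_of_mem_Icc (hwm π a) (fun z => (hwB π a z).1) (fun z => (hwB π a z).2)
    have hri : ∀ (a π : D) (P : ProbabilityMeasure Z), Integrable r (P : Measure Z) :=
      fun a π P => integrable_reward hr hr1 _
    have e1 : ∑ i, (μ i : ℝ) * meanReward r (M i) (b i) = ∑ a, (m a : ℝ) * meanReward r (N a) a :=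
      (hre (fun _ _ => r) (fun a => a) hri).symm
    have e2 : ∀ π, ∑ i, (μ i : ℝ) * meanReward r (M i) π = ∑ a, (m a : ℝ) * meanReward r (N a) π :=
      fun π => (hre (fun _ _ => r) (fun _ => π) hri).symm
    have e3 : ∀ π, ∑ i, (μ i : ℝ) * ∫ z, w π (b i) z ∂(M i π : Measure Z)
        = ∑ a, (m a : ℝ) * ∫ z, w π a z ∂(N a π : Measure Z) :=
      fun π => (hre (fun a π => w π a) (fun _ => π) hwi).symm
    have e4 : ∑ i, (μ i : ℝ) * linObj r η p (fun a π z => p π * w π a z) (M i) (b i)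
        = ∑ i, (μ i : ℝ) * meanReward r (M i) (b i)
          - ∑ π, p π * ∑ i, (μ i : ℝ) * meanReward r (M i) π
          + 1 / η * (∑ π, p π * ∑ i, (μ i : ℝ) * ∫ z, w π (b i) z ∂(M i π : Measure Z) - 1) := by
      have h1 : ∀ i, linObj r η p (fun a π z => p π * w π a z) (M i) (b i)
          = meanReward r (M i) (b i) - ∑ π, p π * meanReward r (M i) π
            + 1 / η * (∑ π, p π * ∫ z, w π (b i) z ∂(M i π : Measure Z) - 1) := by
        intro i
        simp only [linObj, integral_const_mul, mul_sub, Finset.sum_sub_distrib, ← Finset.sum_mul,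
          hp.2, one_mul]
      have h2 : ∀ f : ι → D → ℝ, ∑ i, (μ i : ℝ) * ∑ π, p π * f i π
          = ∑ π, p π * ∑ i, (μ i : ℝ) * f i π := by
        intro f
        simp only [Finset.mul_sum]
        rw [Finset.sum_comm]
        exact Finset.sum_congr rfl fun π _ => Finset.sum_congr rfl fun i _ => by ring
      simp only [h1, mul_add, mul_sub, Finset.sum_add_distrib, Finset.sum_sub_distrib, h2,
        mul_one, ← Finset.sum_mul, hμ', one_mul]
      congr 2
      simp only [mul_left_comm _ (1 / η), ← Finset.mul_sum, h2]
    rw [e4, e1]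
    simp only [e2, e3]
    have h5 : ∑ π, p π * ∑ a, (m a : ℝ) * ∫ z, w π a z ∂(N a π : Measure Z)
        ≤ ∑ π, p π * (1 + κ - 1 / 8 * ∑ a, (m a : ℝ) * hellingerSq (N a π : Measure Z) (Q π)) :=
      Finset.sum_le_sum fun π _ => mul_le_mul_of_nonneg_left (hwo π) (hp.1 π)
    have h6 : ∑ a, (m a : ℝ) * decPayoff r (1 / (8 * η)) p (N a) Q
        ≤ dec r (1 / (8 * η)) (co 𝓜) + κ := by
      calc ∑ a, (m a : ℝ) * decPayoff r (1 / (8 * η)) p (N a) Q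
          ≤ ∑ a, (m a : ℝ) * (dec r (1 / (8 * η)) (co 𝓜) + κ) :=
            Finset.sum_le_sum fun a _ =>
              mul_le_mul_of_nonneg_left (hpd _ (hN a)) (NNReal.coe_nonneg _)
        _ = _ := by rw [← Finset.sum_mul, hm1', one_mul]
    have h7 : ∑ a, (m a : ℝ) * (meanReward r (N a) a - ∑ π, p π * meanReward r (N a) π
          - 1 / (8 * η) * ∑ π, p π * hellingerSq (N a π : Measure Z) (Q π))
        ≤ ∑ a, (m a : ℝ) * decPayoff r (1 / (8 * η)) p (N a) Q := by
      refine Finset.sum_le_sum fun a _ => mul_le_mul_of_nonneg_left ?_ (NNReal.coe_nonneg _)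
      have := meanReward_le_iSup (r := r) (N a) a
      simp only [decPayoff, mul_sub, Finset.sum_sub_distrib, ← Finset.sum_mul, hp.2, one_mul,
        mul_left_comm _ (1 / (8 * η)), ← Finset.mul_sum]
      linarith
    have h8 : ∀ f : D → D → ℝ, ∑ a, (m a : ℝ) * ∑ π, p π * f a π
        = ∑ π, p π * ∑ a, (m a : ℝ) * f a π := by
      intro f
      simp only [Finset.mul_sum]
      rw [Finset.sum_comm]
      exact Finset.sum_congr rfl fun π _ => Finset.sum_congr rfl fun i _ => by ring
    simp only [mul_sub, mul_add, Finset.sum_sub_distrib, Finset.sum_add_distrib, h8,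
      mul_left_comm _ (1 / (8 * η)), mul_left_comm _ (1 / 8 : ℝ), ← Finset.mul_sum,
      ← Finset.sum_mul, hp.2, one_mul, mul_one] at h5 h7
    set X := ∑ π, p π * ∑ a, (m a : ℝ) * hellingerSq (N a π : Measure Z) (Q π)
    have h9 : 1 / η * (∑ π, p π * ∑ a, (m a : ℝ) * ∫ z, w π a z ∂(N a π : Measure Z) - 1)
        ≤ 1 / η * (κ - 1 / 8 * X) :=
      mul_le_mul_of_nonneg_left (by linarith) (by positivity)
    -- The information gain of the weights cancels the Hellinger penalty at γ = 1 / (8 * η).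
    have h10 : 1 / η * (κ - 1 / 8 * X) = κ / η - 1 / (8 * η) * X := by
      field_simp
    linarith

end Strategies

/-- A minimax theorem for finitely many linear objectives. -/
theorem exists_forall_le_of_convex {ι : Type*} [Fintype ι] {A : Set (ι → ℝ)} (hA : Convex ℝ A)
    (hne : A.Nonempty) {c v : ℝ} (hcv : c < v)
    (h : ∀ μ : ι → ℝ≥0, ∑ i, μ i = 1 → ∃ y ∈ A, ∑ i, (μ i : ℝ) * y i ≤ c) :
    ∃ y ∈ A, ∀ i, y i ≤ v := by
  classical
  by_contra hcon
  push Not at hcon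
  -- If no point of A is good, A misses this open orthant. A separating functional, once normalized,
  -- is a mixture violating the hypothesis.
  set B : Set (ι → ℝ) := Set.univ.pi fun _ => Set.Iio v with hB
  have hBA : Disjoint B A := by
    rw [Set.disjoint_left]
    intro y hyB hyA
    obtain ⟨i, hi⟩ := hcon y hyA
    exact absurd (hyB i (Set.mem_univ i)) (not_lt.2 hi.le)
  obtain ⟨f, s, hfB, hfA⟩ := geometric_hahn_banach_open
    (convex_pi fun _ _ => convex_Iio v) (isOpen_set_pi Set.finite_univ fun _ _ => isOpen_Iio) hA hBA
  set d : ι → ℝ := fun i => f fun j => if i = j then 1 else 0 with hd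
  have hf : ∀ y, f y = ∑ i, y i * d i := fun y => by
    simpa using LinearMap.pi_apply_eq_sum_univ (f : (ι → ℝ) →ₗ[ℝ] ℝ) y
  have hd0 : ∀ i, 0 ≤ d i := by
    intro i
    by_contra hi
    push Not at hi
    -- The orthant is unbounded below in coordinate i, which excludes a negative coefficient.
    have key : ∀ t : ℝ, 0 ≤ t → ∑ j, (v - 1) * d j - t * d i < s := by
      intro t ht
      have := hfB (fun j => v - 1 - if j = i then t else 0) fun j _ => by
        simp only [Set.mem_Iio]; split_ifs <;> linarith
      rw [hf] at this
      simpa [sub_mul, Finset.sum_sub_distrib, ite_mul] using this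
    obtain ⟨n, hn⟩ := exists_nat_gt ((s - ∑ j, (v - 1) * d j) / (-d i))
    rw [div_lt_iff₀ (by linarith)] at hn
    have := key n (Nat.cast_nonneg n)
    linarith
  set C := ∑ i, d i with hC
  have hC0 : 0 ≤ C := Finset.sum_nonneg fun i _ => hd0 i
  have hconst : ∀ x < v, x * C < s := by
    intro x hx
    have := hfB (fun _ => x) fun _ _ => hx
    rwa [hf, ← Finset.mul_sum] at this
  have hCpos : 0 < C := by
    rcases hC0.eq_or_lt with h0 | h0
    · have hd' : ∀ i, d i = 0 := fun i =>
        (Finset.sum_eq_zero_iff_of_nonneg fun i _ => hd0 i).1 h0.symm i (Finset.mem_univ i)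
      obtain ⟨y, hy⟩ := hne
      have h1 := hfA y hy
      have h2 := hconst (v - 1) (by linarith)
      rw [hf] at h1
      simp [hd'] at h1
      rw [← h0] at h2
      linarith
    · exact h0
  obtain ⟨y, hyA, hy⟩ := h (fun i => (d i / C).toNNReal) (by
    rw [← NNReal.coe_inj]
    push_cast
    simp only [Real.coe_toNNReal _ (div_nonneg (hd0 _) hC0), ← Finset.sum_div]
    exact div_self hCpos.ne')
  simp only [Real.coe_toNNReal _ (div_nonneg (hd0 _) hC0)] at hy
  have h1 := hfA y hyA
  have h2 := hconst ((c + v) / 2) (by linarith)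
  have h3 : ∑ i, d i / C * y i = f y / C := by
    rw [hf, Finset.sum_div]; exact Finset.sum_congr rfl fun i _ => by ring
  rw [h3, div_le_iff₀ hCpos] at hy
  nlinarith

/-! ### Finitely many pairs of a model and a comparator -/

section Strategies

variable {D Z : Type*} [MeasurableSpace Z] [Fintype D] {r : Z → ℝ} {η : ℝ} {q : D → ℝ} {B : ℝ}

theorem Admissible.convexCombo {p p' : D → ℝ} {u u' : D → D → Z → ℝ} (h : Admissible q B p u)
    (h' : Admissible q B p' u') {s t : ℝ} (hs : 0 ≤ s) (ht : 0 ≤ t) (hst : s + t = 1) :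
    Admissible q B (fun π => s * p π + t * p' π) (fun a π z => s * u a π z + t * u' a π z) where
  mem := convex_stdSimplex ℝ D h.mem h'.mem hs ht hst
  meas a π := ((h.meas a π).const_mul s).add ((h'.meas a π).const_mul t)
  nonneg a π z := add_nonneg (mul_nonneg hs (h.nonneg a π z)) (mul_nonneg ht (h'.nonneg a π z))
  le a π z := by nlinarith [mul_le_mul_of_nonneg_left (h.le a π z) hs,
    mul_le_mul_of_nonneg_left (h'.le a π z) ht]
  dual π z x := by
    simp only [mul_add, Finset.sum_add_distrib, mul_left_comm _ s, mul_left_comm _ t,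
      ← Finset.mul_sum]
    nlinarith [mul_le_mul_of_nonneg_left (h.dual π z x) hs,
      mul_le_mul_of_nonneg_left (h'.dual π z x) ht]

theorem linObj_convexCombo {p p' : D → ℝ} {u u' : D → D → Z → ℝ} (h : Admissible q B p u)
    (h' : Admissible q B p' u') {s t : ℝ} (hst : s + t = 1) (M : Model D Z) (a : D) :
    linObj r η (fun π => s * p π + t * p' π) (fun a π z => s * u a π z + t * u' a π z) M a
      = s * linObj r η p u M a + t * linObj r η p' u' M a := by
  have h1 : ∀ π, ∫ z, (s * u a π z + t * u' a π z) ∂(M π : Measure Z)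
      = s * ∫ z, u a π z ∂(M π : Measure Z) + t * ∫ z, u' a π z ∂(M π : Measure Z) := fun π => by
    rw [integral_add ((h.integrable a π _).const_mul s) ((h'.integrable a π _).const_mul t),
      integral_const_mul, integral_const_mul]
  simp only [linObj, h1, add_mul, Finset.sum_add_distrib, mul_assoc, ← Finset.mul_sum]
  linear_combination (1 / η) * hst

/-- The vectors of objective values of admissible pairs form a convex set, and each mixture of pairs
has a good Bayesian response, so the finite minimax theorem applies. The bound B of the admissible
pairs depends on κ and |D| but not on the finite family, which is what compactness needs. -/
theorem exists_admissible_of_finite [Nonempty D] (hr : Measurable r)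
    (hr1 : ∀ z, r z ∈ Set.Icc (0 : ℝ) 1)
    {κ : ℝ} (hη : 0 < η) (hκ : 0 < κ) (hκ1 : κ ≤ 1) (hq : ∀ a, 0 < q a)
    (hq1 : ∑ a, q a = 1) {ι : Type*} [Fintype ι]
    (M : ι → Model D Z) (b : ι → D) {𝓜 : Set (Model D Z)} (hne : 𝓜.Nonempty)
    (hM : ∀ i, M i ∈ co 𝓜) {v : ℝ} (hv : dec r (1 / (8 * η)) (co 𝓜) + (κ + κ / η) < v) :
    ∃ p u, Admissible q ((Fintype.card D + 1) / κ) p u ∧ ∀ i, linObj r η p u (M i) (b i) ≤ v := by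
  obtain ⟨M₀, hM₀⟩ := hne
  obtain ⟨p₀, u₀, h₀, -⟩ := exists_admissible_of_mixture hr hr1 hη hκ hκ1 hq hq1
    (ι := Unit) (fun _ => 1) (by simp) (fun _ => M₀) (fun _ => Classical.arbitrary D)
    (fun _ => subset_co hM₀)
  have hA : Convex ℝ {y : ι → ℝ | ∃ p u, Admissible q ((Fintype.card D + 1) / κ) p u ∧
      ∀ i, y i = linObj r η p u (M i) (b i)} := by
    rintro y ⟨p, u, h, hy⟩ y' ⟨p', u', h', hy'⟩ s t hs ht hst
    refine ⟨_, _, h.convexCombo h' hs ht hst, fun i => ?_⟩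
    rw [linObj_convexCombo h h' hst, ← hy, ← hy']
    rfl
  obtain ⟨y, ⟨p, u, h, hy⟩, hyv⟩ := exists_forall_le_of_convex hA
    ⟨_, p₀, u₀, h₀, fun i => rfl⟩ hv fun μ hμ => by
      obtain ⟨p, u, h, hle⟩ := exists_admissible_of_mixture hr hr1 hη hκ hκ1 hq hq1 μ hμ M b hM
      exact ⟨_, ⟨p, u, h, fun i => rfl⟩, hle⟩
  exact ⟨p, u, h, fun i => hy i ▸ hyv i⟩

end Strategies

/-! ### Passage to a dominated class by compactness -/

section Compactness

variable {D Z : Type*} [MeasurableSpace Z] [Fintype D] {r : Z → ℝ} {η : ℝ} {q : D → ℝ} {B : ℝ}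

/-- Linear inequalities pass to weak limits. -/
theorem ae_nonneg_of_weak_limit {α : Type*} (𝒰 : Ultrafilter α) (ν : Measure Z) [IsFiniteMeasure ν]
    {u : α → D → Z → ℝ} {v : D → Z → ℝ} {p : α → ℝ} {p' : ℝ} (hp : Tendsto p 𝒰 (𝓝 p'))
    (hu : ∀ F a (m : Measure Z), IsFiniteMeasure m → Integrable (u F a) m)
    (hv : ∀ a, ∀ m : Measure Z, IsFiniteMeasure m → m ≪ ν → Integrable (v a) m ∧
      Tendsto (fun F => ∫ z, u F a z ∂m) 𝒰 (𝓝 (∫ z, v a z ∂m)))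
    (l : D → ℝ) (c : ℝ) (h : ∀ F z, 0 ≤ ∑ a, l a * u F a z + c * p F) :
    ∀ᵐ z ∂ν, 0 ≤ ∑ a, l a * v a z + c * p' := by
  have hsum : ∀ (m : Measure Z), IsFiniteMeasure m → ∀ (f : D → Z → ℝ) (x : ℝ),
      (∀ a, Integrable (f a) m) →
      ∫ z, (∑ a, l a * f a z + x) ∂m = ∑ a, l a * ∫ z, f a z ∂m + m.real Set.univ * x := by
    intro m hm f x hf
    rw [integral_add (integrable_finsetSum _ fun a _ => (hf a).const_mul _) (integrable_const _),
      integral_finsetSum _ fun a _ => (hf a).const_mul _]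
    simp [integral_const_mul]
  refine ae_nonneg_of_forall_setIntegral_nonneg ?_ fun A hA _ => ?_
  · exact (integrable_finsetSum _ fun a _ => (((hv a) ν inferInstance
      Measure.AbsolutelyContinuous.rfl).1).const_mul _).add (integrable_const _)
  · have hac : ν.restrict A ≪ ν := Measure.restrict_le_self.absolutelyContinuous
    rw [hsum _ inferInstance v _ fun a => (hv a _ inferInstance hac).1]
    refine ge_of_tendsto (x := (𝒰 : Filter α)) (f := fun F => ∑ a, l a * ∫ z, u F a z ∂(ν.restrict A)
      + (ν.restrict A).real Set.univ * (c * p F)) ?_ (Eventually.of_forall fun F => ?_)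
    · exact (tendsto_finsetSum _ fun a _ => ((hv a _ inferInstance hac).2).const_mul _).add
        ((hp.const_mul c).const_mul _)
    · rw [← hsum _ inferInstance (u F) _ fun a => hu F a _ inferInstance]
      exact integral_nonneg fun z => h F z

/-- Both sides are continuous in s. Countably many test vectors thus suffice, so the dual
constraints hold simultaneously almost everywhere. -/
theorem sq_sum_le_of_forall_rat {p' : ℝ} {v : D → ℝ}
    (h : ∀ s : D → ℚ, p' * (∑ a, (s a : ℝ) * √(q a)) ^ 2 ≤ ∑ a, (s a : ℝ) ^ 2 * v a)
    (s : D → ℝ) : p' * (∑ a, s a * √(q a)) ^ 2 ≤ ∑ a, s a ^ 2 * v a := by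
  have hd : DenseRange (Pi.map fun (_ : D) (x : ℚ) => (x : ℝ)) :=
    DenseRange.piMap fun _ => Rat.denseRange_cast
  have hc : IsClosed {s : D → ℝ | p' * (∑ a, s a * √(q a)) ^ 2 ≤ ∑ a, s a ^ 2 * v a} :=
    isClosed_le (by fun_prop) (by fun_prop)
  exact hd.induction_on (p := fun s => p' * (∑ a, s a * √(q a)) ^ 2 ≤ ∑ a, s a ^ 2 * v a) s hc h

theorem summable_measureReal {ι : Type*} [Countable ι] {m : Measure Z} [IsFiniteMeasure m]
    {f : ι → Set Z} (hf : ∀ i, MeasurableSet (f i)) (hd : Pairwise (Function.onFun Disjoint f)) :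
    Summable fun i => m.real (f i) :=
  ENNReal.summable_toReal (measure_iUnion hd hf ▸ measure_ne_top m _)

theorem pairwise_disjoint_cells {W ι : Type*} (cell : W → ι) (S : Set ι) :
    Pairwise (Function.onFun Disjoint fun i : S => cell ⁻¹' {i.1}) := by
  intro i j hij
  rw [Function.onFun, Set.disjoint_left]
  intro z hi hj
  exact hij (Subtype.ext (hi.symm.trans hj))

/-- Integrals with respect to a measure concentrated on countably many cells. -/
theorem tsum_setIntegral_cells {ι : Type*} {cell : Z → ι}
    (hcell : ∀ i, MeasurableSet (cell ⁻¹' {i})) {m : Measure Z} {S : Set ι} (hS : S.Countable)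
    (hm : m (cell ⁻¹' S)ᶜ = 0) {f : Z → ℝ} (hf : Integrable f m) :
    ∑' i : S, ∫ z in cell ⁻¹' {i.1}, f z ∂m = ∫ z, f z ∂m := by
  have := hS.to_subtype
  have hU : (⋃ i : S, cell ⁻¹' {i.1}) = cell ⁻¹' S := by
    ext z; simp
  rw [← integral_iUnion (fun i : S => hcell i.1) (pairwise_disjoint_cells cell S) hf.integrableOn, hU,
    setIntegral_eq_integral_of_ae_compl_eq_zero]
  have : ∀ᵐ z ∂m, z ∈ cell ⁻¹' S := hm
  filter_upwards [this] with z hz hz'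
  exact absurd hz hz'

/-- Finitely satisfiable bounds on the linear objective are satisfiable on a dominated class. -/
theorem exists_admissible_of_dominated {Z : Type v} [MeasurableSpace Z] {r : Z → ℝ}
    {𝓚 : Set (Model D Z)} (hdom : Dominated 𝓚)
    (hq : ∀ a, 0 < q a) (hq1 : ∑ a, q a = 1) (hB : 1 ≤ B) {c : ℝ}
    (hfin : ∀ F : Finset (𝓚 × D), ∃ p u, Admissible q B p u ∧
      ∀ x ∈ F, linObj r η p u x.1.1 x.2 ≤ c) :
    ∃ p u, Admissible q B p u ∧ ∀ M ∈ 𝓚, ∀ a, linObj r η p u M a ≤ c := by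
  classical
  obtain ⟨ι, cell, ν, hcell, hmeas, hσ, habs⟩ := hdom
  choose p u hadm hobj using hfin
  -- As 𝒰 is finer than `atTop`, every single pair eventually belongs to F, and its bound passes to
  -- the limit.
  set 𝒰 : Ultrafilter (Finset (𝓚 × D)) := Ultrafilter.of atTop with h𝒰
  have h𝒰le : (𝒰 : Filter (Finset (𝓚 × D))) ≤ atTop := Ultrafilter.of_le _
  have hp1 : ∀ F π, p F π ≤ 1 := fun F π => by
    rw [← (hadm F).mem.2]
    exact Finset.single_le_sum (fun b _ => (hadm F).mem.1 b) (Finset.mem_univ π)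
  have hB0 : 0 ≤ B := zero_le_one.trans hB
  choose pl hpl hplim using fun π => exists_tendsto_ultrafilter 𝒰 (fun F => p F π) 0 1
    fun F => ⟨(hadm F).mem.1 π, hp1 F π⟩
  have hplsum : ∑ π, pl π = 1 := by
    refine tendsto_nhds_unique (tendsto_finsetSum Finset.univ fun π _ => hplim π) ?_
    simp only [(hadm _).mem.2]
    exact tendsto_const_nhds
  have huB : ∀ F a π z, u F a π z ≤ B := fun F a π z =>
    ((hadm F).le a π z).trans (mul_le_of_le_one_left hB0 (hp1 F π))
  choose v hvm hv using fun i a π => exists_weak_limit 𝒰 (ν i).toFinite B (fun F => u F a π)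
    (fun F => (hadm F).meas a π) (fun F => (hadm F).nonneg a π) (fun F => huB F a π)
  -- The points of cell i at which the weak limits satisfy the pointwise constraints.
  set G : ι → Set Z := fun i => {z | ∀ π, (∀ a, 0 ≤ v i a π z ∧ v i a π z ≤ pl π * B) ∧
    ∀ s : D → ℚ, pl π * (∑ a, (s a : ℝ) * √(q a)) ^ 2 ≤ ∑ a, (s a : ℝ) ^ 2 * v i a π z} with hG
  have hGm : ∀ i, MeasurableSet (G i) := by
    intro i
    simp only [hG, Set.ofPred_forall, Set.ofPred_and]
    refine MeasurableSet.iInter fun π => MeasurableSet.inter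
      (MeasurableSet.iInter fun a => MeasurableSet.inter ?_ ?_) (MeasurableSet.iInter fun s => ?_)
    · exact measurableSet_le measurable_const (hvm i a π)
    · exact measurableSet_le (hvm i a π) measurable_const
    · exact measurableSet_le measurable_const
        (Finset.measurable_fun_sum _ fun a _ => (hvm i a π).const_mul _)
  have hGae : ∀ i, ∀ᵐ z ∂(ν i).toFinite, z ∈ G i := by
    intro i
    have key : ∀ π (l : D → ℝ) (x : ℝ), (∀ F z, 0 ≤ ∑ a, l a * u F a π z + x * p F π) →
        ∀ᵐ z ∂(ν i).toFinite, 0 ≤ ∑ a, l a * v i a π z + x * pl π := fun π l x h =>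
      ae_nonneg_of_weak_limit 𝒰 _ (hplim π) (fun F a m _ => (hadm F).integrable a π m)
        (fun a => hv i a π) l x h
    have h1 : ∀ π a, ∀ᵐ z ∂(ν i).toFinite, 0 ≤ v i a π z := fun π a => by
      have := key π (fun b => if b = a then 1 else 0) 0 fun F z => by
        simpa using (hadm F).nonneg a π z
      simpa using this
    have h2 : ∀ π a, ∀ᵐ z ∂(ν i).toFinite, v i a π z ≤ pl π * B := fun π a => by
      have := key π (fun b => if b = a then -1 else 0) B fun F z => by
        have := (hadm F).le a π z
        simp
        linarith
      filter_upwards [this] with z hz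
      simp at hz
      linarith
    have h3 : ∀ π, ∀ s : D → ℚ, ∀ᵐ z ∂(ν i).toFinite,
        pl π * (∑ a, (s a : ℝ) * √(q a)) ^ 2 ≤ ∑ a, (s a : ℝ) ^ 2 * v i a π z := fun π s => by
      have := key π (fun a => (s a : ℝ) ^ 2) (-(∑ a, (s a : ℝ) * √(q a)) ^ 2) fun F z => by
        have := (hadm F).dual π z fun a => (s a : ℝ)
        linarith
      filter_upwards [this] with z hz
      linarith
    refine ae_all_iff.2 fun π => ?_
    filter_upwards [ae_all_iff.2 (h1 π), ae_all_iff.2 (h2 π), ae_all_iff.2 (h3 π)] with z a1 a2 a3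
    exact ⟨fun a => ⟨a1 a, a2 a⟩, a3⟩
  -- The default value corresponds to constant weights 1, admissible since ∑ q = 1 and 1 ≤ B.
  set U : D → D → Z → ℝ := fun a π z => if z ∈ G (cell z) then v (cell z) a π z else pl π with hU
  have hadmU : Admissible q B pl U := by
    refine ⟨⟨fun π => (hpl π).1, hplsum⟩, fun a π => ?_, fun a π z => ?_, fun a π z => ?_,
      fun π z s => ?_⟩
    · intro A hA
      -- There may be uncountably many cells; gluing is measurable because measurability is tested
      -- cell by cell.
      refine hmeas _ fun i => ?_
      have : U a π ⁻¹' A ∩ cell ⁻¹' {i}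
          = (fun z => if z ∈ G i then v i a π z else pl π) ⁻¹' A ∩ cell ⁻¹' {i} := by
        ext z
        simp only [Set.mem_inter_iff, Set.mem_preimage, Set.mem_singleton_iff]
        refine and_congr_left fun hz => ?_
        simp only [hU, hz]
      rw [this]
      exact ((Measurable.ite (hGm i) (hvm i a π) measurable_const) hA).inter (hcell i)
    · simp only [hU]
      split_ifs with hz
      · exact ((hz π).1 a).1
      · exact (hpl π).1
    · simp only [hU]
      split_ifs with hz
      · exact ((hz π).1 a).2
      · exact le_mul_of_one_le_right (hpl π).1 hB
    · simp only [hU]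
      split_ifs with hz
      · exact sq_sum_le_of_forall_rat (hz π).2 s
      · have := sq_sum_le_of_sum_div_le (w := fun _ : D => 1) (fun a => (hq a).le)
          (fun _ => one_pos) (by simp [hq1]) s
        have := mul_le_mul_of_nonneg_left this (hpl π).1
        simpa only [mul_one, ← Finset.sum_mul, mul_comm (pl π) (∑ a, s a ^ 2)] using this
  have hlim : ∀ M ∈ 𝓚, ∀ a π, Tendsto (fun F => ∫ z, u F a π z ∂(M π : Measure Z)) 𝒰
      (𝓝 (∫ z, U a π z ∂(M π : Measure Z))) := by
    intro M hM a π
    -- M π charges only countably many cells, so the limit is exchanged with a series majorized by B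
    -- times the masses of the cells.
    obtain ⟨S, hS, hSc, hSac⟩ := habs M hM π
    have := hS.to_subtype
    rw [← tsum_setIntegral_cells hcell hS hSc (hadmU.integrable a π _)]
    simp only [← tsum_setIntegral_cells hcell hS hSc ((hadm _).integrable a π _)]
    have hac : ∀ i ∈ S, (M π : Measure Z).restrict (cell ⁻¹' {i}) ≪ (ν i).toFinite := fun i hi =>
      (hSac i hi).trans (absolutelyContinuous_toFinite (ν i))
    have hUv : ∀ i ∈ S, ∫ z in cell ⁻¹' {i}, U a π z ∂(M π : Measure Z)
        = ∫ z in cell ⁻¹' {i}, v i a π z ∂(M π : Measure Z) := by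
      intro i hi
      refine integral_congr_ae ?_
      filter_upwards [(hac i hi).ae_le (hGae i), ae_restrict_mem (hcell i)] with z hz hz'
      have hz' : cell z = i := hz'
      simp only [hU, hz', if_pos hz]
    refine tendsto_tsum_of_dominated_convergence
      (bound := fun i : S => B * (M π : Measure Z).real (cell ⁻¹' {i.1})) ?_ (fun i => ?_)
      (Eventually.of_forall fun F i => ?_)
    · refine Summable.mul_left B ?_
      exact summable_measureReal (fun i : S => hcell i.1) (pairwise_disjoint_cells cell S)
    · rw [hUv i.1 i.2]
      exact (hv i.1 a π _ inferInstance (hac i.1 i.2)).2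
    · rw [Real.norm_of_nonneg (integral_nonneg ((hadm F).nonneg a π))]
      simpa using integral_le_mul_real (m := (M π : Measure Z).restrict (cell ⁻¹' {i.1}))
        ((hadm F).meas a π) ((hadm F).nonneg a π) (huB F a π)
  refine ⟨pl, U, hadmU, fun M hM a => ?_⟩
  have hl : Tendsto (fun F => linObj r η (p F) (u F) M a) 𝒰 (𝓝 (linObj r η pl U M a)) :=
    (tendsto_finsetSum _ fun π _ => (hplim π).mul_const _).add
      (((tendsto_finsetSum _ fun π _ => hlim M hM a π).sub_const 1).const_mul _)
  refine le_of_tendsto hl (h𝒰le ?_)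
  filter_upwards [eventually_ge_atTop ({(⟨M, hM⟩, a)} : Finset (𝓚 × D))] with F hF
  exact hobj F (⟨M, hM⟩, a) (hF (Finset.mem_singleton_self _))

end Compactness

/-! ### Undoing the rounding of outcomes -/

section Rounding

variable {D : Type*} {Z : Type v} [MeasurableSpace Z] [Fintype D] {r : Z → ℝ} {η : ℝ} {q : D → ℝ}
  {B : ℝ}

theorem integral_bind_of_mem_Icc {m : Measure Z} [IsFiniteMeasure m] (K : Kernel Z Z)
    [IsMarkovKernel K] {f : Z → ℝ} {b : ℝ} (hf : Measurable f) (h0 : ∀ z, 0 ≤ f z)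
    (hb : ∀ z, f z ≤ b) : ∫ z, f z ∂(m.bind K) = ∫ z, ∫ y, f y ∂(K z) ∂m := by
  have hm : StronglyMeasurable fun z => ∫ y, f y ∂(K z) := hf.stronglyMeasurable.integral_kernel
  rw [integral_eq_lintegral_of_nonneg_ae (Eventually.of_forall h0) hf.aestronglyMeasurable,
    integral_eq_lintegral_of_nonneg_ae (Eventually.of_forall fun z => integral_nonneg h0)
      hm.aestronglyMeasurable,
    Measure.lintegral_bind K.aemeasurable hf.ennreal_ofReal.aemeasurable]
  congr 2
  ext z
  rw [ofReal_integral_eq_lintegral_ofReal (integrable_of_mem_Icc hf h0 hb)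
    (Eventually.of_forall h0)]

/-- For fixed p all constraints are linear in u, so they survive averaging. The learner in effect
rounds the outcome itself, but uses the mean over the rounding. -/
theorem Admissible.bind {p : D → ℝ} {u : D → D → Z → ℝ} (h : Admissible q B p u)
    (K : D → Kernel Z Z) [∀ π, IsMarkovKernel (K π)] :
    Admissible q B p fun a π z => ∫ y, u a π y ∂(K π z) where
  mem := h.mem
  meas a π := ((h.meas a π).stronglyMeasurable.integral_kernel).measurable
  nonneg a π z := integral_nonneg (h.nonneg a π)
  le a π z := by
    simpa using integral_le_mul_real (m := K π z) (h.meas a π) (h.nonneg a π) (h.le a π)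
  dual π z s := by
    simp only [← integral_const_mul]
    rw [← integral_finsetSum _ fun a _ => (h.integrable a π _).const_mul _]
    calc p π * (∑ a, s a * √(q a)) ^ 2 = ∫ _, p π * (∑ a, s a * √(q a)) ^ 2 ∂(K π z) := by simp
      _ ≤ _ := integral_mono (integrable_const _)
          (integrable_finsetSum _ fun a _ => (h.integrable a π _).const_mul _) (h.dual π · s)

/-- The value of the linear problem is at most the decision-estimation coefficient of the hull. -/
theorem exists_admissible_of_regular [Nonempty D] (hr : Measurable r)
    (hr1 : ∀ z, r z ∈ Set.Icc (0 : ℝ) 1) (hη : 0 < η) (hq : ∀ a, 0 < q a) (hq1 : ∑ a, q a = 1)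
    {𝓜 : Set (Model D Z)} (hne : 𝓜.Nonempty) (hreg : RegularClass r 𝓜) {c : ℝ}
    (hc : dec r (1 / (8 * η)) (co 𝓜) < c) :
    ∃ B p u, Admissible q B p u ∧ ∀ M ∈ 𝓜, ∀ a, linObj r η p u M a ≤ c := by
  obtain ⟨K, hK, 𝓚, h𝓚, hdom, hround⟩ := hreg
  set Δ := c - dec r (1 / (8 * η)) (co 𝓜) with hΔ
  have hΔ0 : 0 < Δ := sub_pos.2 hc
  -- Chosen so that κ + κ / η = κ * (1 + 1 / η) is at most half of the gap Δ.
  set κ := min 1 (Δ / (2 * (1 + 1 / η))) with hκ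
  have hη' : 0 < 1 + 1 / η := by positivity
  have hκ0 : 0 < κ := lt_min one_pos (by positivity)
  have hκ1 : κ ≤ 1 := min_le_left _ _
  have hκΔ : κ + κ / η < Δ := by
    have h1 : κ ≤ Δ / (2 * (1 + 1 / η)) := min_le_right _ _
    rw [le_div_iff₀ (by positivity)] at h1
    have h2 : κ + κ / η = κ * (1 + 1 / η) := by ring
    rw [h2]
    linarith
  have hB : 1 ≤ ((Fintype.card D : ℝ) + 1) / κ :=
    (one_le_div hκ0).2 (hκ1.trans (by linarith [Nat.cast_nonneg (α := ℝ) (Fintype.card D)]))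
  obtain ⟨p, u, hadm, hobj⟩ := exists_admissible_of_dominated (r := r) (η := η) (c := c) hdom hq
    hq1 hB fun F => by
      obtain ⟨p, u, h, hle⟩ := exists_admissible_of_finite hr hr1 hη hκ0 hκ1 hq hq1 (ι := F)
        (fun x => x.1.1.1) (fun x => x.1.2) hne (fun x => h𝓚 x.1.1.2) (v := c) (by linarith)
      exact ⟨p, u, h, fun x hx => hle ⟨x, hx⟩⟩
  refine ⟨_, p, _, hadm.bind K, fun M hM a => ?_⟩
  obtain ⟨N, hN, hNM⟩ := hround M hM
  have := hobj N hN a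
  have e : ∀ π, ∫ z, u a π z ∂(M π : Measure Z).bind (K π)
      = ∫ z, ∫ y, u a π y ∂(K π z) ∂(M π : Measure Z) := fun π =>
    integral_bind_of_mem_Icc (K π) (hadm.meas a π) (hadm.nonneg a π) (hadm.le a π)
  simpa only [linObj, (hNM _).1, (hNM _).2, e] using this

end Rounding

/-! ### From the linearized problem back to the exponential objective -/

section Objective

variable {D Z : Type*} [MeasurableSpace Z] [Fintype D] {r : Z → ℝ} {η : ℝ} {q p : D → ℝ}

/-- The exponential moment in the objective. -/
def exoMoment (η : ℝ) (q p : D → ℝ) (g : D → D → Z → ℝ) (a : D) (M : Model D Z) : ℝ≥0∞ :=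
  ∑ π, ENNReal.ofReal (p π) *
    ∫⁻ z, ∑ π', ENNReal.ofReal (q π' * Real.exp (η / p π * (g π' π z - g a π z)))
      ∂(M π : Measure Z)

/-- This moves bounds between `EReal` and `ℝ≥0∞`. The second conjunct is needed because
`ENNReal.ofReal` sends negative numbers to 0. -/
theorem exoObj_le_iff (hη : 0 < η) {g : D → D → Z → ℝ} {a : D} {M : Model D Z} {c : ℝ} :
    exoObj r η q p g a M ≤ (c : EReal) ↔
      exoMoment η q p g a M ≤
          ENNReal.ofReal (1 + η * (c - ∑ π, p π * (meanReward r M a - meanReward r M π))) ∧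
        0 ≤ 1 + η * (c - ∑ π, p π * (meanReward r M a - meanReward r M π)) := by
  have h : exoObj r η q p g a M
      = ((∑ π, p π * (meanReward r M a - meanReward r M π) : ℝ) : EReal)
        + ((ENNReal.ofReal (1 / η) * exoMoment η q p g a M : ℝ≥0∞) : EReal)
        - ((1 / η : ℝ) : EReal) := rfl
  rw [h]
  generalize ∑ π, p π * (meanReward r M a - meanReward r M π) = R
  induction exoMoment η q p g a M with
  | top =>
    have : ENNReal.ofReal (1 / η) ≠ 0 := by simpa using hη
    rw [ENNReal.mul_top this, EReal.coe_ennreal_top, EReal.coe_add_top, EReal.top_sub_coe]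
    simp
  | coe x =>
    have h1 : ((ENNReal.ofReal (1 / η) * (x : ℝ≥0∞) : ℝ≥0∞) : EReal)
        = ((1 / η * (x : ℝ) : ℝ) : EReal) := by
      rw [ENNReal.ofReal, ← ENNReal.coe_mul, EReal.coe_nnreal_eq_coe_real, NNReal.coe_mul,
        Real.coe_toNNReal _ (by positivity)]
    rw [h1, ← EReal.coe_add, ← EReal.coe_sub, EReal.coe_le_coe_iff]
    have h2 : R + 1 / η * (x : ℝ) - 1 / η ≤ c ↔ (x : ℝ) ≤ 1 + η * (c - R) := by
      rw [← mul_le_mul_iff_of_pos_left hη]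
      have : η * (R + 1 / η * (x : ℝ) - 1 / η) = η * R + x - 1 := by field_simp
      rw [this]
      constructor <;> intro h <;> linarith
    rw [h2]
    constructor
    · intro h3
      have h4 := x.2.trans h3
      refine ⟨?_, h4⟩
      rw [← ENNReal.ofReal_coe_nnreal]
      exact ENNReal.ofReal_le_ofReal h3
    · rintro ⟨h3, h4⟩
      rw [← ENNReal.ofReal_coe_nnreal] at h3
      exact (ENNReal.ofReal_le_ofReal_iff h4).1 h3

/-- The indicator of a as test vector gives u ≥ p q, so log u is meaningful wherever p is positive.
-/
theorem Admissible.pos_weight {B : ℝ} {u : D → D → Z → ℝ} (h : Admissible q B p u)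
    (hq : ∀ a, 0 < q a) {π : D} (hπ : 0 < p π) (a : D) (z : Z) : 0 < u a π z := by
  classical
  have := h.dual π z fun b => if b = a then 1 else 0
  simp only [ite_mul, one_mul, zero_mul, Finset.sum_ite_eq', Finset.mem_univ, if_true,
    Real.sq_sqrt (hq a).le, ite_pow, one_pow, ne_eq, OfNat.ofNat_ne_zero, not_false_eq_true,
    zero_pow] at this
  exact (mul_pos hπ (hq a)).trans_le this

/-- The test vector √q / u is extremal: with X = ∑ q / u the dual inequality becomes p X² ≤ X. -/
theorem Admissible.sum_div_le {B : ℝ} {u : D → D → Z → ℝ} (h : Admissible q B p u)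
    (hq : ∀ a, 0 < q a) {π : D} (hπ : 0 < p π) (z : Z) : p π * ∑ a, q a / u a π z ≤ 1 := by
  have hu := h.pos_weight hq hπ
  have hd := h.dual π z fun a => √(q a) / u a π z
  have e1 : ∀ a, √(q a) / u a π z * √(q a) = q a / u a π z := fun a => by
    rw [div_mul_eq_mul_div, Real.mul_self_sqrt (hq a).le]
  have e2 : ∀ a, (√(q a) / u a π z) ^ 2 * u a π z = q a / u a π z := fun a => by
    rw [div_pow, Real.sq_sqrt (hq a).le]
    have := (hu a z).ne'
    field_simp
  simp only [e1, e2] at hd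
  set X := ∑ a, q a / u a π z
  have hX : 0 ≤ X := Finset.sum_nonneg fun a _ => (div_pos (hq a) (hu a z)).le
  rcases hX.eq_or_lt with h0 | h0
  · rw [← h0]; simp
  · nlinarith

/-- Every admissible pair gives an estimation function with at most the same objective. -/
theorem Admissible.exists_estimator {B : ℝ} {u : D → D → Z → ℝ} (h : Admissible q B p u)
    (hη : 0 < η) (hq : ∀ a, 0 < q a) :
    ∃ g : D → D → Z → ℝ, (∀ π' π, Measurable (g π' π)) ∧
      ∀ M a, exoObj r η q p g a M ≤ (linObj r η p u M a : EReal) := by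
  -- This inverts the substitution: the exponential becomes u a / u b, and the moment is at most ∫ u
  -- a. Where p π = 0 the term has weight zero.
  refine ⟨fun a π z => -(p π / η) * Real.log (u a π z), fun a π =>
    (h.meas a π).log.const_mul _, fun M a => ?_⟩
  rw [exoObj_le_iff hη]
  have e : 1 + η * (linObj r η p u M a - ∑ π, p π * (meanReward r M a - meanReward r M π))
      = ∑ π, ∫ z, u a π z ∂(M π : Measure Z) := by
    simp only [linObj]
    field_simp
    ring
  have h0 : ∀ π, 0 ≤ ∫ z, u a π z ∂(M π : Measure Z) := fun π => integral_nonneg (h.nonneg a π)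
  rw [e]
  refine ⟨?_, Finset.sum_nonneg fun π _ => h0 π⟩
  rw [ENNReal.ofReal_sum_of_nonneg fun π _ => h0 π, exoMoment]
  refine Finset.sum_le_sum fun π _ => ?_
  rcases (h.mem.1 π).eq_or_lt with hπ | hπ
  · rw [← hπ]; simp
  · rw [ofReal_integral_eq_lintegral_ofReal (h.integrable a π _)
      (Eventually.of_forall (h.nonneg a π)), ← lintegral_const_mul' _ _ ENNReal.ofReal_ne_top]
    refine lintegral_mono fun z => ?_
    have hu := h.pos_weight hq hπ
    have e1 : ∀ b, q b * Real.exp (η / p π * (-(p π / η) * Real.log (u b π z)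
        - -(p π / η) * Real.log (u a π z))) = u a π z * (q b / u b π z) := by
      intro b
      have : η / p π * (-(p π / η) * Real.log (u b π z) - -(p π / η) * Real.log (u a π z))
          = Real.log (u a π z) - Real.log (u b π z) := by
        field_simp
        ring
      rw [this, Real.exp_sub, Real.exp_log (hu a z), Real.exp_log (hu b z)]
      ring
    simp only [e1]
    rw [← ENNReal.ofReal_sum_of_nonneg fun b _ =>
        mul_nonneg (hu a z).le (div_pos (hq b) (hu b z)).le,
      ← ENNReal.ofReal_mul hπ.le, ← Finset.mul_sum]
    refine ENNReal.ofReal_le_ofReal ?_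
    have := mul_le_mul_of_nonneg_left (h.sum_div_le hq hπ z) (hu a z).le
    linarith

theorem le_coe_of_forall_real {x : EReal} {c : ℝ} (h : ∀ b : ℝ, c < b → x ≤ b) : x ≤ c := by
  refine le_of_forall_gt_imp_ge_of_dense fun y hy => ?_
  obtain ⟨b, hb, hby⟩ := EReal.lt_iff_exists_real_btwn.1 hy
  exact (h b (EReal.coe_lt_coe_iff.1 hb)).trans hby.le

/-- The minimax value of exploration-by-optimization is bounded by the decision-estimation
coefficient of the convex hull. -/
theorem exo_le_dec {D : Type*} {Z : Type v} [MeasurableSpace Z] [Fintype D] [Nonempty D]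
    {r : Z → ℝ} {q : D → ℝ} (hr : Measurable r)
    (hr1 : ∀ z, r z ∈ Set.Icc (0 : ℝ) 1) (hη : 0 < η) (hq : ∀ a, 0 < q a) (hq1 : ∑ a, q a = 1)
    {𝓜 : Set (Model D Z)} (hne : 𝓜.Nonempty) (hreg : RegularClass r 𝓜) :
    exo r η 𝓜 q ≤ (dec r (1 / (8 * η)) (co 𝓜) : EReal) := by
  refine le_coe_of_forall_real fun c hc => ?_
  obtain ⟨B, p, u, h, hle⟩ := exists_admissible_of_regular hr hr1 hη hq hq1 hne hreg hc
  obtain ⟨g, hg, hobj⟩ := h.exists_estimator (r := r) hη hq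
  refine (iInf₂_le p h.mem).trans ((iInf₂_le g hg).trans ?_)
  exact iSup₂_le fun M hM => iSup_le fun a =>
    (hobj M a).trans (EReal.coe_le_coe_iff.2 (hle M hM a))

end Objective

/-! ### Integration against the conditional law of a round -/

section Disintegration

/-- Integration against a conditional law given on rectangles. -/
theorem setLIntegral_of_conditional_law {Ω Ω' Z : Type*} [MeasurableSpace Ω] [MeasurableSpace Ω']
    [MeasurableSpace Z] (P : Measure Ω) [IsFiniteMeasure P] {φ : Ω → Ω'} (hφ : Measurable φ)
    {Y : Ω → Z} (hY : Measurable Y) {S : Set Ω} {d : Ω' → ℝ≥0∞}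
    (hd : Measurable d) (κ : Kernel Ω' Z) [IsMarkovKernel κ]
    (law : ∀ E, MeasurableSet E → ∀ A, MeasurableSet A →
      P (φ ⁻¹' E ∩ (S ∩ Y ⁻¹' A)) = ∫⁻ ω in φ ⁻¹' E, d (φ ω) * κ (φ ω) A ∂P)
    {G : Ω' × Z → ℝ≥0∞} (hG : Measurable G) :
    ∫⁻ ω in S, G (φ ω, Y ω) ∂P = ∫⁻ ω, d (φ ω) * ∫⁻ z, G (φ ω, z) ∂(κ (φ ω)) ∂P := by
  have hmeas : (P.restrict S).map (fun ω => (φ ω, Y ω)) = ((P.map φ).withDensity d) ⊗ₘ κ := by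
    -- The law hypothesis gives both measures the same values on rectangles, which determine a
    -- finite measure on the product.
    refine Measure.ext_prod fun {E A} hE hA => ?_
    rw [Measure.map_apply (hφ.prodMk hY) (hE.prod hA), Measure.compProd_apply_prod hE hA,
      Measure.restrict_apply ((hφ.prodMk hY) (hE.prod hA)),
      setLIntegral_withDensity_eq_setLIntegral_mul _ hd (κ.measurable_coe hA) hE,
      setLIntegral_map hE (hd.mul (κ.measurable_coe hA)) hφ]
    have h := law E hE A hA
    simp only [Pi.mul_apply]
    rw [← h]
    congr 1
    ext ω
    simp only [Set.mem_inter_iff, Set.mem_preimage, Set.mem_prod]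
    tauto
  have h1 : Measurable fun x => ∫⁻ z, G (x, z) ∂(κ x) := hG.lintegral_kernel_prod_right'
  rw [← lintegral_map (f := G) (g := fun ω => (φ ω, Y ω)) hG (hφ.prodMk hY), hmeas,
    Measure.lintegral_compProd hG, lintegral_withDensity_eq_lintegral_mul _ hd h1,
    lintegral_map (hd.mul h1) hφ]
  rfl

end Disintegration

/-! ### Histories and measurability of the weights -/

section History

variable {D Z : Type*} [MeasurableSpace D] [MeasurableSpace Z]

/-- The history before round `t`. -/
def Interaction.hist {𝓜 : Set (Model D Z)} {L : Learner D Z} {T : ℕ} {Ω : Type*}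
    [MeasurableSpace Ω] {P : Measure Ω} (I : Interaction 𝓜 L T P) (t : ℕ) (ω : Ω) : Fin t → D × Z :=
  fun i => (I.act i ω, I.out i ω)

variable [Fintype D] [DiscreteMeasurableSpace D]

theorem Learner.measurable_est (L : Learner D Z) {t : ℕ} (i : Fin t) (π : D) :
    Measurable fun h : Fin t → D × Z => L.est h i π := by
  have hpre : Measurable fun (h : Fin t → D × Z) (j : Fin i) => h (Fin.castLE i.2.le j) :=
    measurable_pi_lambda _ fun j => measurable_pi_apply _
  have hg : Measurable fun x : ((Fin i → D × Z) × Z) × D => L.g i x.1.1 π x.2 x.1.2 :=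
    measurable_from_prod_countable_left fun d => L.measurable_g i π d
  have hp : Measurable fun x : (Fin i → D × Z) × D => L.p i x.1 x.2 :=
    measurable_from_prod_countable_left fun d => L.measurable_p i d
  have h1 : Measurable fun h : Fin t → D × Z => (h i).1 := (measurable_pi_apply i).fst
  have h2 : Measurable fun h : Fin t → D × Z => (h i).2 := (measurable_pi_apply i).snd
  exact (hg.comp ((hpre.prodMk h2).prodMk h1)).div (hp.comp (hpre.prodMk h1))

theorem Learner.measurable_expWeights (L : Learner D Z) (η : ℝ) {t : ℕ} (π : D) :
    Measurable fun h : Fin t → D × Z => L.expWeights η h π := by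
  have h1 : ∀ π, Measurable fun h : Fin t → D × Z => Real.exp (η * ∑ i, L.est h i π) := fun π =>
    ((Finset.measurable_fun_sum _ fun i _ => L.measurable_est i π).const_mul _).exp
  exact (h1 π).div (Finset.measurable_fun_sum _ fun π' _ => h1 π')

omit [DiscreteMeasurableSpace D] in
theorem Learner.expWeights_pos [Nonempty D] (L : Learner D Z) (η : ℝ) {t : ℕ}
    (h : Fin t → D × Z) (π : D) : 0 < L.expWeights η h π :=
  div_pos (Real.exp_pos _) (Finset.sum_pos (fun _ _ => Real.exp_pos _) Finset.univ_nonempty)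

omit [DiscreteMeasurableSpace D] in
theorem Learner.sum_expWeights [Nonempty D] (L : Learner D Z) (η : ℝ) {t : ℕ}
    (h : Fin t → D × Z) : ∑ π, L.expWeights η h π = 1 := by
  simp only [Learner.expWeights, ← Finset.sum_div]
  exact div_self (Finset.sum_pos (fun _ _ => Real.exp_pos _) Finset.univ_nonempty).ne'

end History

/-! ### Telescoping of exponential weights -/

section Telescoping

/-- The potential argument for exponential weights. -/
theorem prod_expWeights {D : Type*} [Fintype D] [Nonempty D] (η : ℝ) (e : ℕ → D → ℝ) (a : D)
    (T : ℕ) :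
    ∏ s ∈ Finset.range T, ∑ π, Real.exp (η * ∑ i ∈ Finset.range s, e i π)
        / (∑ π', Real.exp (η * ∑ i ∈ Finset.range s, e i π')) * Real.exp (η * (e s π - e s a))
      = (∑ π, Real.exp (η * ∑ i ∈ Finset.range T, e i π))
        * Real.exp (-(η * ∑ i ∈ Finset.range T, e i a)) / Fintype.card D := by
  induction T with
  | zero => simp
  | succ T ih =>
    rw [Finset.prod_range_succ, ih]
    have hW : (∑ π, Real.exp (η * ∑ i ∈ Finset.range T, e i π)) ≠ 0 :=
      (Finset.sum_pos (fun _ _ => Real.exp_pos _) Finset.univ_nonempty).ne'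
    set W := ∑ π, Real.exp (η * ∑ i ∈ Finset.range T, e i π)
    have h1 : ∀ π, Real.exp (η * ∑ i ∈ Finset.range T, e i π) / W
          * Real.exp (η * (e T π - e T a))
        = Real.exp (η * ∑ i ∈ Finset.range (T + 1), e i π) * (Real.exp (-(η * e T a)) / W) := by
      intro π
      rw [Finset.sum_range_succ, div_mul_eq_mul_div, ← mul_div_assoc, ← Real.exp_add,
        ← Real.exp_add]
      congr 2
      ring
    simp only [h1]
    rw [← Finset.sum_mul, Finset.sum_range_succ _ T, mul_add η, neg_add, Real.exp_add]
    field_simp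

/-- The final potential contains the summand of a, which alone cancels the factor exp(-η ∑ e a). -/
theorem card_inv_le_prod_expWeights {D : Type*} [Fintype D] [Nonempty D] (η : ℝ) (e : ℕ → D → ℝ)
    (a : D) (T : ℕ) :
    1 / (Fintype.card D : ℝ) ≤
      ∏ s ∈ Finset.range T, ∑ π, Real.exp (η * ∑ i ∈ Finset.range s, e i π)
        / (∑ π', Real.exp (η * ∑ i ∈ Finset.range s, e i π')) * Real.exp (η * (e s π - e s a)) := by
  rw [prod_expWeights]
  refine div_le_div_of_nonneg_right ?_ (Nat.cast_nonneg _)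
  calc (1 : ℝ) = Real.exp (η * ∑ i ∈ Finset.range T, e i a)
        * Real.exp (-(η * ∑ i ∈ Finset.range T, e i a)) := by rw [← Real.exp_add]; simp
    _ ≤ _ := mul_le_mul_of_nonneg_right (Finset.single_le_sum
        (f := fun π => Real.exp (η * ∑ i ∈ Finset.range T, e i π))
        (fun _ _ => (Real.exp_pos _).le) (Finset.mem_univ a)) (Real.exp_pos _).le

end Telescoping

/-! ### The exponential supermartingale and the regret bound -/

section Supermartingale

variable {D Z : Type*} [MeasurableSpace D] [DiscreteMeasurableSpace D] [MeasurableSpace Z]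
  [Fintype D] {r : Z → ℝ} {η : ℝ} {𝓜 : Set (Model D Z)} {L : Learner D Z} {T : ℕ} {Ω : Type*}
  [mΩ : MeasurableSpace Ω] {P : Measure Ω}

omit [DiscreteMeasurableSpace D] [Fintype D] in
theorem Interaction.measurable_hist (I : Interaction 𝓜 L T P) {t : ℕ} (ht : t ≤ T) :
    Measurable[I.ℱ t] (I.hist t) := by
  refine @measurable_pi_lambda _ _ _ (I.ℱ t) _ _ fun i => ?_
  have hi : (i : ℕ) < T := i.2.trans_le ht
  have hle : I.ℱ (i + 1) ≤ I.ℱ t := I.ℱ.mono i.2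
  exact ((I.measurable_act i hi).mono hle le_rfl).prodMk ((I.measurable_out i hi).mono hle le_rfl)

/-- The tower property for round t, derived from a law given only on rectangles. The integrand may
depend on all information in ℱ t, including the adversary's private randomness. -/
theorem Interaction.lintegral_round [IsProbabilityMeasure P] (I : Interaction 𝓜 L T P) {t : ℕ}
    (ht : t < T) (G : D → Ω × Z → ℝ≥0∞)
    (hG : ∀ π, Measurable[(I.ℱ t).prod inferInstance] (G π)) :
    ∫⁻ ω, G (I.act t ω) (ω, I.out t ω) ∂P
      = ∫⁻ ω, ∑ π, ENNReal.ofReal (L.p t (I.hist t ω) π)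
          * ∫⁻ z, G π (ω, z) ∂(I.model t ω π : Measure Z) ∂P := by
  classical
  have hle : I.ℱ t ≤ mΩ := I.ℱ.le t
  have hact : Measurable (I.act t) := (I.measurable_act t ht).mono (I.ℱ.le _) le_rfl
  have hout : Measurable (I.out t) := (I.measurable_out t ht).mono (I.ℱ.le _) le_rfl
  have hG' : ∀ π, Measurable (G π) := fun π =>
    (hG π).mono (sup_le_sup (MeasurableSpace.comap_mono hle) le_rfl) le_rfl
  have hset : ∀ π, MeasurableSet {ω | I.act t ω = π} := fun π => hact (measurableSet_singleton π)
  have hp : ∀ π, Measurable[I.ℱ t] fun ω => ENNReal.ofReal (L.p t (I.hist t ω) π) := fun π =>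
    ENNReal.measurable_ofReal.comp ((L.measurable_p t π).comp (I.measurable_hist ht.le))
  let κ : D → @Kernel Ω Z (I.ℱ t) _ := fun π =>
    @Kernel.mk Ω Z (I.ℱ t) _ (fun ω => (I.model t ω π : Measure Z)) (I.measurable_model t ht π)
  have hκ : ∀ π, @IsMarkovKernel Ω Z (I.ℱ t) _ (κ π) := fun π =>
    @IsMarkovKernel.mk Ω Z (I.ℱ t) _ (κ π) fun ω =>
      inferInstanceAs (IsProbabilityMeasure (I.model t ω π : Measure Z))
  have key : ∀ π, ∫⁻ ω in {ω | I.act t ω = π}, G π (ω, I.out t ω) ∂P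
      = ∫⁻ ω, ENNReal.ofReal (L.p t (I.hist t ω) π)
          * ∫⁻ z, G π (ω, z) ∂(I.model t ω π : Measure Z) ∂P := fun π =>
    -- Conditioning on ℱ t: the map is the identity from Ω to Ω with the smaller σ-algebra.
    @setLIntegral_of_conditional_law Ω Ω Z mΩ (I.ℱ t) _ P _ id (measurable_id'' hle) _ hout _ _
      (hp π) (κ π) (hκ π) (fun E hE A hA => I.law t ht E hE π A hA) _ (hG π)
  have hsplit : ∀ ω, G (I.act t ω) (ω, I.out t ω)
      = ∑ π, {ω | I.act t ω = π}.indicator (fun ω => G π (ω, I.out t ω)) ω := by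
    intro ω
    simp [Set.indicator_apply]
  have hmG : ∀ π, Measurable fun ω => G π (ω, I.out t ω) := fun π =>
    (hG' π).comp (measurable_id.prodMk hout)
  simp only [hsplit]
  rw [lintegral_finsetSum _ fun π _ => (hmG π).indicator (hset π)]
  simp only [lintegral_indicator (hset _), key]
  rw [lintegral_finsetSum]
  intro π _
  have h1 : Measurable[I.ℱ t] fun ω => ∫⁻ z, G π (ω, z) ∂(I.model t ω π : Measure Z) :=
    @Measurable.lintegral_kernel_prod_right' Ω Z (I.ℱ t) _ (κ π) inferInstance _ (hG π)
  exact ((hp π).mono hle le_rfl).mul (h1.mono hle le_rfl)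

/-- The instantaneous regret of round `t` against the decision `a`. -/
def Interaction.instRegret (I : Interaction 𝓜 L T P) (r : Z → ℝ) (t : ℕ) (a : D) (ω : Ω) : ℝ :=
  ∑ π, L.p t (I.hist t ω) π * (meanReward r (I.model t ω) a - meanReward r (I.model t ω) π)

/-- The exponential factor of round `t` at the decision `π` and the outcome `z`. -/
def Learner.expFactor (L : Learner D Z) (η : ℝ) (t : ℕ) (a π : D) (x : (Fin t → D × Z) × Z) :
    ℝ≥0∞ :=
  ∑ π', ENNReal.ofReal (L.expWeights η x.1 π'
    * Real.exp (η / L.p t x.1 π * (L.g t x.1 π' π x.2 - L.g t x.1 a π x.2)))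

theorem Learner.measurable_expFactor (L : Learner D Z) (η : ℝ) (t : ℕ) (a π : D) :
    Measurable (L.expFactor η t a π) := by
  refine Finset.measurable_fun_sum _ fun π' _ => ENNReal.measurable_ofReal.comp ?_
  refine ((L.measurable_expWeights η π').comp measurable_fst).mul (Measurable.exp ?_)
  exact (((L.measurable_p t π).comp measurable_fst).const_div _).mul
    ((L.measurable_g t π' π).sub (L.measurable_g t a π))

/-- The exponential supermartingale of the analysis. -/
def Interaction.expSupermart (I : Interaction 𝓜 L T P) (r : Z → ℝ) (η b : ℝ) (a : D) (t : ℕ)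
    (ω : Ω) : ℝ≥0∞ :=
  ∏ s ∈ Finset.range t, ENNReal.ofReal (Real.exp (η * (I.instRegret r s a ω - b)))
    * L.expFactor η s a (I.act s ω) (I.hist s ω, I.out s ω)

omit [MeasurableSpace D] [DiscreteMeasurableSpace D] [Fintype D] mΩ in
theorem measurable_meanReward {m : MeasurableSpace Ω} (hr : Measurable r)
    (hr1 : ∀ z, r z ∈ Set.Icc (0 : ℝ) 1) {M : Ω → Model D Z} {π : D}
    (hM : Measurable[m] fun ω => (M ω π : Measure Z)) :
    Measurable[m] fun ω => meanReward r (M ω) π := by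
  have h : ∀ ω, meanReward r (M ω) π
      = (∫⁻ z, ENNReal.ofReal (r z) ∂(M ω π : Measure Z)).toReal := fun ω =>
    integral_eq_lintegral_of_nonneg_ae (Eventually.of_forall fun z => (hr1 z).1)
      hr.aestronglyMeasurable
  simp only [h]
  exact ENNReal.measurable_toReal.comp
    ((Measure.measurable_lintegral hr.ennreal_ofReal).comp hM)

omit [DiscreteMeasurableSpace D] in
theorem Interaction.measurable_instRegret (I : Interaction 𝓜 L T P) (hr : Measurable r)
    (hr1 : ∀ z, r z ∈ Set.Icc (0 : ℝ) 1) {t : ℕ} (ht : t < T) (a : D) :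
    Measurable[I.ℱ t] (I.instRegret r t a) :=
  Finset.measurable_fun_sum _ fun π _ =>
    ((L.measurable_p t π).comp (I.measurable_hist ht.le)).mul
      ((measurable_meanReward hr hr1 (I.measurable_model t ht a)).sub
        (measurable_meanReward hr hr1 (I.measurable_model t ht π)))

theorem Interaction.measurable_expSupermart (I : Interaction 𝓜 L T P) (hr : Measurable r)
    (hr1 : ∀ z, r z ∈ Set.Icc (0 : ℝ) 1) {b : ℝ} {t : ℕ} (ht : t ≤ T) (a : D) :
    Measurable[I.ℱ t] (I.expSupermart r η b a t) := by
  refine Finset.measurable_fun_prod _ fun s hs => ?_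
  have hst : s < t := Finset.mem_range.1 hs
  have hsT : s < T := hst.trans_le ht
  have hle : I.ℱ s ≤ I.ℱ t := I.ℱ.mono hst.le
  have hle' : I.ℱ (s + 1) ≤ I.ℱ t := I.ℱ.mono hst
  have h0 : Measurable[I.ℱ t] fun ω =>
      ENNReal.ofReal (Real.exp (η * (I.instRegret r s a ω - b))) :=
    ENNReal.measurable_ofReal.comp (Real.measurable_exp.comp
      ((((I.measurable_instRegret hr hr1 hsT a).mono hle le_rfl).sub_const b).const_mul η))
  have hF : Measurable[I.ℱ t] fun ω => L.expFactor η s a (I.act s ω) (I.hist s ω, I.out s ω) := by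
    have h1 : Measurable fun x : ((Fin s → D × Z) × Z) × D => L.expFactor η s a x.2 x.1 :=
      measurable_from_prod_countable_left fun π => L.measurable_expFactor η s a π
    have h2 : Measurable[I.ℱ t] fun ω => ((I.hist s ω, I.out s ω), I.act s ω) :=
      (((I.measurable_hist hsT.le).mono hle le_rfl).prodMk
        ((I.measurable_out s hsT).mono hle' le_rfl)).prodMk
          ((I.measurable_act s hsT).mono hle' le_rfl)
    have h3 : ∀ F : ((Fin s → D × Z) × Z) × D → ℝ≥0∞, Measurable F →
        Measurable[I.ℱ t] fun ω => F ((I.hist s ω, I.out s ω), I.act s ω) := fun F hF => by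
      exact hF.comp h2
    have h4 := h3 _ h1
    exact h4
  exact h0.mul hF

theorem exp_mul_one_sub_le (x : ℝ) : Real.exp x * (1 - x) ≤ 1 := by
  have h := Real.add_one_le_exp (-x)
  calc Real.exp x * (1 - x) ≤ Real.exp x * Real.exp (-x) :=
        mul_le_mul_of_nonneg_left (by linarith) (Real.exp_pos x).le
    _ = 1 := by rw [← Real.exp_add]; simp

/-- Given ℱ t, the new exponential factor has mean `exoMoment`, at most 1 - x with x = η(R - b) by
the bound on the objective. It comes multiplied by exp x, and exp x * (1 - x) ≤ 1. -/
theorem Interaction.lintegral_expSupermart_succ_le [IsProbabilityMeasure P]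
    (I : Interaction 𝓜 L T P) (hr : Measurable r) (hr1 : ∀ z, r z ∈ Set.Icc (0 : ℝ) 1)
    (hη : 0 < η) {b : ℝ} {t : ℕ} (ht : t < T) (a : D)
    (hobj : ∀ h : Fin t → D × Z, ∀ M ∈ 𝓜,
      exoObj r η (L.expWeights η h) (L.p t h) (L.g t h) a M ≤ (b : EReal)) :
    ∫⁻ ω, I.expSupermart r η b a (t + 1) ω ∂P ≤ ∫⁻ ω, I.expSupermart r η b a t ω ∂P := by
  set c : Ω → ℝ≥0∞ := fun ω =>
    I.expSupermart r η b a t ω * ENNReal.ofReal (Real.exp (η * (I.instRegret r t a ω - b))) with hc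
  have hcm : Measurable[I.ℱ t] c :=
    (I.measurable_expSupermart hr hr1 ht.le a).mul (ENNReal.measurable_ofReal.comp
      (Real.measurable_exp.comp (((I.measurable_instRegret hr hr1 ht a).sub_const b).const_mul η)))
  have h1 : ∀ ω, I.expSupermart r η b a (t + 1) ω
      = c ω * L.expFactor η t a (I.act t ω) (I.hist t ω, I.out t ω) := fun ω => by
    simp only [Interaction.expSupermart, hc, Finset.prod_range_succ, mul_assoc]
  have hfst : Measurable[(I.ℱ t).prod inferInstance, I.ℱ t] fun x : Ω × Z => x.1 :=
    @measurable_fst Ω Z (I.ℱ t) _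
  have hsnd : Measurable[(I.ℱ t).prod inferInstance] fun x : Ω × Z => x.2 :=
    @measurable_snd Ω Z (I.ℱ t) _
  have hG : ∀ π, Measurable[(I.ℱ t).prod inferInstance] fun x : Ω × Z =>
      c x.1 * L.expFactor η t a π (I.hist t x.1, x.2) := by
    intro π
    have h2 : Measurable[(I.ℱ t).prod inferInstance] fun x : Ω × Z => (I.hist t x.1, x.2) :=
      ((I.measurable_hist ht.le).comp hfst).prodMk hsnd
    exact (hcm.comp hfst).mul ((L.measurable_expFactor η t a π).comp h2)
  simp only [h1]
  rw [I.lintegral_round ht (fun π x => c x.1 * L.expFactor η t a π (I.hist t x.1, x.2)) hG]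
  refine lintegral_mono fun ω => ?_
  have h2 : ∀ π, Measurable fun z => L.expFactor η t a π (I.hist t ω, z) := fun π =>
    (L.measurable_expFactor η t a π).comp measurable_prodMk_left
  have h3 : ∑ π, ENNReal.ofReal (L.p t (I.hist t ω) π)
        * ∫⁻ z, c ω * L.expFactor η t a π (I.hist t ω, z) ∂(I.model t ω π : Measure Z)
      = c ω * exoMoment η (L.expWeights η (I.hist t ω)) (L.p t (I.hist t ω))
          (L.g t (I.hist t ω)) a (I.model t ω) := by
    rw [exoMoment, Finset.mul_sum]
    refine Finset.sum_congr rfl fun π _ => ?_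
    rw [lintegral_const_mul _ (h2 π), mul_left_comm]
    rfl
  obtain ⟨h4, -⟩ := (exoObj_le_iff hη).1 (hobj (I.hist t ω) _ (I.model_mem t ht ω))
  simp only [h3]
  calc c ω * exoMoment η (L.expWeights η (I.hist t ω)) (L.p t (I.hist t ω))
          (L.g t (I.hist t ω)) a (I.model t ω)
      ≤ c ω * ENNReal.ofReal (1 + η * (b - I.instRegret r t a ω)) := by gcongr; exact h4
    _ = I.expSupermart r η b a t ω * ENNReal.ofReal (Real.exp (η * (I.instRegret r t a ω - b))
          * (1 - η * (I.instRegret r t a ω - b))) := by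
        rw [hc, mul_assoc, ← ENNReal.ofReal_mul (Real.exp_pos _).le]
        congr 3
        ring
    _ ≤ I.expSupermart r η b a t ω * 1 := by
        gcongr
        rw [← ENNReal.ofReal_one]
        exact ENNReal.ofReal_le_ofReal (exp_mul_one_sub_le _)
    _ = I.expSupermart r η b a t ω := mul_one _

theorem Interaction.lintegral_expSupermart_le [IsProbabilityMeasure P]
    (I : Interaction 𝓜 L T P) (hr : Measurable r) (hr1 : ∀ z, r z ∈ Set.Icc (0 : ℝ) 1)
    (hη : 0 < η) {b : ℝ} (a : D)
    (hobj : ∀ t < T, ∀ h : Fin t → D × Z, ∀ M ∈ 𝓜,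
      exoObj r η (L.expWeights η h) (L.p t h) (L.g t h) a M ≤ (b : EReal)) :
    ∀ t ≤ T, ∫⁻ ω, I.expSupermart r η b a t ω ∂P ≤ 1 := by
  intro t
  induction t with
  | zero => intro _; simp [Interaction.expSupermart]
  | succ t ih =>
    intro ht
    exact (I.lintegral_expSupermart_succ_le hr hr1 hη ht a (hobj t ht)).trans (ih (by omega))

/-- The realised estimate of round `i`. -/
def Interaction.estimate (I : Interaction 𝓜 L T P) (ω : Ω) (i : ℕ) (π : D) : ℝ :=
  L.g i (I.hist i ω) π (I.act i ω) (I.out i ω) / L.p i (I.hist i ω) (I.act i ω)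

omit [DiscreteMeasurableSpace D] in
theorem Interaction.expFactor_eq (I : Interaction 𝓜 L T P) (η : ℝ) (s : ℕ) (a : D) (ω : Ω) :
    L.expFactor η s a (I.act s ω) (I.hist s ω, I.out s ω)
      = ENNReal.ofReal (∑ π, Real.exp (η * ∑ i ∈ Finset.range s, I.estimate ω i π)
        / (∑ π', Real.exp (η * ∑ i ∈ Finset.range s, I.estimate ω i π'))
          * Real.exp (η * (I.estimate ω s π - I.estimate ω s a))) := by
  have h1 : ∀ π, ∑ i : Fin s, L.est (I.hist s ω) i π
      = ∑ i ∈ Finset.range s, I.estimate ω i π := fun π =>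
    Fin.sum_univ_eq_sum_range (fun i => I.estimate ω i π) s
  rw [ENNReal.ofReal_sum_of_nonneg fun π _ => mul_nonneg (div_nonneg (Real.exp_pos _).le
    (Finset.sum_nonneg fun _ _ => (Real.exp_pos _).le)) (Real.exp_pos _).le]
  refine Finset.sum_congr rfl fun π _ => ?_
  simp only [Learner.expWeights, h1, Interaction.estimate]
  congr 3
  ring

-- A bound on every path: telescoping eliminates the estimates, leaving only the true regret and a
-- factor 1/|D|.
omit [DiscreteMeasurableSpace D] in
theorem Interaction.le_expSupermart [Nonempty D] (I : Interaction 𝓜 L T P) (r : Z → ℝ) (η b : ℝ)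
    (a : D) (t : ℕ) (ω : Ω) :
    ENNReal.ofReal (Real.exp (η * (∑ s ∈ Finset.range t, I.instRegret r s a ω - t * b))
      / Fintype.card D) ≤ I.expSupermart r η b a t ω := by
  have h0 : ∀ s, 0 ≤ ∑ π, Real.exp (η * ∑ i ∈ Finset.range s, I.estimate ω i π)
        / (∑ π', Real.exp (η * ∑ i ∈ Finset.range s, I.estimate ω i π'))
          * Real.exp (η * (I.estimate ω s π - I.estimate ω s a)) := fun s =>
    Finset.sum_nonneg fun π _ => mul_nonneg (div_nonneg (Real.exp_pos _).le
      (Finset.sum_nonneg fun _ _ => (Real.exp_pos _).le)) (Real.exp_pos _).le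
  simp only [Interaction.expSupermart, I.expFactor_eq]
  rw [Finset.prod_mul_distrib, ← ENNReal.ofReal_prod_of_nonneg fun s _ => (Real.exp_pos _).le,
    ← ENNReal.ofReal_prod_of_nonneg fun s _ => h0 s,
    ← ENNReal.ofReal_mul (Finset.prod_nonneg fun s _ => (Real.exp_pos _).le), ← Real.exp_sum]
  refine ENNReal.ofReal_le_ofReal ?_
  rw [← Finset.mul_sum, Finset.sum_sub_distrib]
  simp only [Finset.sum_const, Finset.card_range, nsmul_eq_mul]
  rw [div_eq_mul_one_div]
  exact mul_le_mul_of_nonneg_left (card_inv_le_prod_expWeights η _ a t) (Real.exp_pos _).le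

/-- Exploration-by-optimization with objective at most `b` has regret at most
`bT + (2/η) log(|D|/δ)` with probability at least `1 - δ`. -/
theorem Interaction.regret_bound [Nonempty D] [IsProbabilityMeasure P]
    (I : Interaction 𝓜 L T P) (hr : Measurable r) (hr1 : ∀ z, r z ∈ Set.Icc (0 : ℝ) 1)
    (hη : 0 < η) {b δ : ℝ} (hδ : 0 < δ)
    (hobj : ∀ a, ∀ t < T, ∀ h : Fin t → D × Z, ∀ M ∈ 𝓜,
      exoObj r η (L.expWeights η h) (L.p t h) (L.g t h) a M ≤ (b : EReal)) :
    ENNReal.ofReal (1 - δ)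
      ≤ P {ω | I.regret r ω ≤ b * T + 2 / η * Real.log (Fintype.card D / δ)} := by
  rcases le_or_gt 1 δ with h1 | h1
  · rw [ENNReal.ofReal_of_nonpos (by linarith)]
    exact zero_le
  set N : ℝ := (Fintype.card D : ℝ) with hN
  have hN1 : 1 ≤ N := by rw [hN]; exact_mod_cast Fintype.card_pos
  have hN0 : 0 < N := by linarith
  set good := {ω | I.regret r ω ≤ b * T + 2 / η * Real.log (N / δ)} with hgood
  -- By Markov's inequality each such event has probability at most δ / N, and the union runs over N
  -- comparators.
  set bad : D → Set Ω := fun a => {ω | ENNReal.ofReal (N / δ) ≤ I.expSupermart r η b a T ω} with hbad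
  have hsub : goodᶜ ⊆ ⋃ a, bad a := by
    intro ω hω
    have hω' : b * T + 2 / η * Real.log (N / δ) < I.regret r ω := not_le.1 hω
    obtain ⟨a, ha⟩ := exists_lt_of_lt_ciSup hω'
    refine Set.mem_iUnion.2 ⟨a, le_trans ?_ (I.le_expSupermart r η b a T ω)⟩
    change b * T + 2 / η * Real.log (N / δ) < ∑ s ∈ Finset.range T, I.instRegret r s a ω at ha
    refine ENNReal.ofReal_le_ofReal ?_
    rw [le_div_iff₀ hN0]
    have h2 : 2 * Real.log (N / δ) ≤ η * (∑ s ∈ Finset.range T, I.instRegret r s a ω - T * b) := by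
      have h3 : 2 / η * Real.log (N / δ) ≤ ∑ s ∈ Finset.range T, I.instRegret r s a ω - T * b := by
        linarith
      calc 2 * Real.log (N / δ) = η * (2 / η * Real.log (N / δ)) := by field_simp
        _ ≤ _ := mul_le_mul_of_nonneg_left h3 hη.le
    -- One N comes from the telescoped weights, N / δ from the threshold; with δ < 1 both fit into
    -- (N / δ)², whence the factor 2 before the logarithm.
    calc N / δ * N ≤ N / δ * (N / δ) := by
          refine mul_le_mul_of_nonneg_left ?_ (by positivity)
          rw [le_div_iff₀ hδ]
          nlinarith
      _ = Real.exp (2 * Real.log (N / δ)) := by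
          rw [two_mul, Real.exp_add, Real.exp_log (by positivity)]
      _ ≤ _ := Real.exp_le_exp.2 h2
  have hbadP : ∀ a, P (bad a) ≤ ENNReal.ofReal (δ / N) := by
    intro a
    have hm : Measurable (I.expSupermart r η b a T) :=
      (I.measurable_expSupermart hr hr1 le_rfl a).mono (I.ℱ.le T) le_rfl
    have hpos : 0 < N / δ := by positivity
    refine (meas_ge_le_lintegral_div hm.aemeasurable (by simpa using hpos)
      ENNReal.ofReal_ne_top).trans ?_
    refine (ENNReal.div_le_div_right
      (I.lintegral_expSupermart_le hr hr1 hη a (hobj a) T le_rfl) _).trans ?_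
    rw [← ENNReal.ofReal_one, ← ENNReal.ofReal_div_of_pos hpos, one_div_div]
  have htot : P goodᶜ ≤ ENNReal.ofReal δ := by
    refine (measure_mono hsub).trans ((measure_iUnion_le _).trans ?_)
    rw [tsum_fintype]
    refine (Finset.sum_le_sum fun a _ => hbadP a).trans ?_
    rw [Finset.sum_const, Finset.card_univ, nsmul_eq_mul, ← ENNReal.ofReal_natCast,
      ← ENNReal.ofReal_mul (Nat.cast_nonneg _), mul_div_cancel₀ _ hN0.ne']
  rw [ENNReal.ofReal_sub _ hδ.le, ENNReal.ofReal_one, tsub_le_iff_right]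
  calc (1 : ℝ≥0∞) = P Set.univ := measure_univ.symm
    _ = P (good ∪ goodᶜ) := by rw [Set.union_compl_self]
    _ ≤ P good + P goodᶜ := measure_union_le _ _
    _ ≤ P good + ENNReal.ofReal δ := by gcongr

end Supermartingale

/-! ### Stability of the objective in the reference distribution -/

section Continuity

variable {D Z : Type*} [MeasurableSpace Z] [Fintype D] {r : Z → ℝ} {η : ℝ} {q p : D → ℝ}

/-- The exponential moment is nonnegative, so dropping it costs only the subtracted 1 / η. -/
theorem coe_le_exoObj (r : Z → ℝ) (η : ℝ) (q p : D → ℝ) (g : D → D → Z → ℝ) (a : D)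
    (M : Model D Z) :
    ((∑ π, p π * (meanReward r M a - meanReward r M π) - 1 / η : ℝ) : EReal)
      ≤ exoObj r η q p g a M := by
  rw [EReal.coe_sub]
  exact EReal.sub_le_sub (le_add_of_nonneg_right (EReal.coe_ennreal_nonneg _)) le_rfl

theorem exoSup_le_iff {𝓜 : Set (Model D Z)} {g : D → D → Z → ℝ} {c : EReal} :
    exoSup r η 𝓜 q p g ≤ c ↔ ∀ M ∈ 𝓜, ∀ a, exoObj r η q p g a M ≤ c := by
  simp only [exoSup, iSup_le_iff]

theorem exo_le_exoSup {𝓜 : Set (Model D Z)} (hp : p ∈ stdSimplex ℝ D) {g : D → D → Z → ℝ}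
    (hg : ∀ π' π, Measurable (g π' π)) : exo r η 𝓜 q ≤ exoSup r η 𝓜 q p g :=
  (iInf₂_le p hp).trans (iInf₂_le g hg)

/-- The minimax value is at least `-1/η`. -/
theorem neg_inv_le_exo [Nonempty D] {𝓜 : Set (Model D Z)} (hne : 𝓜.Nonempty) :
    ((-(1 / η) : ℝ) : EReal) ≤ exo r η 𝓜 q := by
  obtain ⟨M, hM⟩ := hne
  -- Against the best decision of a single model, every p has nonnegative regret.
  obtain ⟨a, ha⟩ := Finite.exists_max (meanReward r M)
  refine le_iInf₂ fun p hp => le_iInf₂ fun g _ => ?_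
  refine le_trans ?_ (exoSup_le_iff.1 le_rfl M hM a)
  refine le_trans (EReal.coe_le_coe_iff.2 ?_) (coe_le_exoObj r η q p g a M)
  have : 0 ≤ ∑ π, p π * (meanReward r M a - meanReward r M π) :=
    Finset.sum_nonneg fun π _ => mul_nonneg (hp.1 π) (sub_nonneg.2 (ha π))
  linarith

theorem neg_one_le_regret (hr : Measurable r) (hr1 : ∀ z, r z ∈ Set.Icc (0 : ℝ) 1)
    (hp : p ∈ stdSimplex ℝ D) (M : Model D Z) (a : D) :
    -1 ≤ ∑ π, p π * (meanReward r M a - meanReward r M π) := by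
  calc (-1 : ℝ) = ∑ π, p π * (-1) := by rw [← Finset.sum_mul, hp.2, one_mul]
    _ ≤ _ := Finset.sum_le_sum fun π _ => mul_le_mul_of_nonneg_left
        (by linarith [(meanReward_mem_Icc hr hr1 M a).1, (meanReward_mem_Icc hr hr1 M π).2])
        (hp.1 π)

theorem exoMoment_le_mul {q₀ : D → ℝ} {κ : ℝ} (hκ : 0 ≤ κ) (h : ∀ a, q a ≤ (1 + κ) * q₀ a)
    (g : D → D → Z → ℝ) (a : D) (M : Model D Z) :
    exoMoment η q p g a M ≤ ENNReal.ofReal (1 + κ) * exoMoment η q₀ p g a M := by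
  rw [exoMoment, exoMoment, Finset.mul_sum]
  refine Finset.sum_le_sum fun π _ => ?_
  rw [mul_left_comm]
  gcongr
  rw [← lintegral_const_mul' _ _ ENNReal.ofReal_ne_top]
  refine lintegral_mono fun z => ?_
  rw [Finset.mul_sum]
  refine Finset.sum_le_sum fun π' _ => ?_
  rw [← ENNReal.ofReal_mul (by linarith), ← mul_assoc]
  exact ENNReal.ofReal_le_ofReal (mul_le_mul_of_nonneg_right (h π') (Real.exp_pos _).le)

/-- The objective is stable under multiplicative perturbations of the reference distribution. -/
theorem exoObj_le_of_le_mul (hr : Measurable r) (hr1 : ∀ z, r z ∈ Set.Icc (0 : ℝ) 1)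
    (hη : 0 < η) {q₀ : D → ℝ} {κ : ℝ} (hκ : 0 ≤ κ) (h : ∀ a, q a ≤ (1 + κ) * q₀ a)
    (hp : p ∈ stdSimplex ℝ D) {g : D → D → Z → ℝ} {a : D} {M : Model D Z} {c : ℝ}
    (hc : exoObj r η q₀ p g a M ≤ (c : EReal)) :
    exoObj r η q p g a M ≤ ((c + κ * (1 / η + c + 1) : ℝ) : EReal) := by
  rw [exoObj_le_iff hη] at hc ⊢
  obtain ⟨h1, h2⟩ := hc
  have hR := neg_one_le_regret hr hr1 hp M a
  set R := ∑ π, p π * (meanReward r M a - meanReward r M π)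
  -- The summand 1 in the error term absorbs the regret, which is at least -1.
  have h3 : (1 + κ) * (1 + η * (c - R)) ≤ 1 + η * (c + κ * (1 / η + c + 1) - R) := by
    have : 1 + η * (c + κ * (1 / η + c + 1) - R)
        = (1 + κ) * (1 + η * (c - R)) + κ * η * (1 + R) := by
      field_simp
      ring
    rw [this]
    have : 0 ≤ κ * η * (1 + R) := mul_nonneg (mul_nonneg hκ hη.le) (by linarith)
    linarith
  refine ⟨(exoMoment_le_mul hκ h g a M).trans ?_, le_trans (mul_nonneg (by linarith) h2) h3⟩
  calc ENNReal.ofReal (1 + κ) * exoMoment η q₀ p g a M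
      ≤ ENNReal.ofReal (1 + κ) * ENNReal.ofReal (1 + η * (c - R)) := by gcongr
    _ = ENNReal.ofReal ((1 + κ) * (1 + η * (c - R))) := (ENNReal.ofReal_mul (by linarith)).symm
    _ ≤ _ := ENNReal.ofReal_le_ofReal h3

end Continuity

/-! ### Measurable choice of approximate minimizers -/

section Selection

variable {D : Type*} {Z : Type v} [MeasurableSpace Z] [Fintype D] [Nonempty D] {r : Z → ℝ}
  {η : ℝ} {𝓜 : Set (Model D Z)}

/-- The value lies between -1/η and the coefficient, which is at most 1; hence `EReal` arithmetic
with it is harmless. -/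
theorem exists_exo_eq_coe (hr : Measurable r) (hr1 : ∀ z, r z ∈ Set.Icc (0 : ℝ) 1) (hη : 0 < η)
    (hne : 𝓜.Nonempty) (hreg : RegularClass r 𝓜) {q : D → ℝ} (hq : ∀ a, 0 < q a)
    (hq1 : ∑ a, q a = 1) : ∃ c : ℝ, c ≤ 1 ∧ exo r η 𝓜 q = (c : EReal) := by
  have h1 := exo_le_dec hr hr1 hη hq hq1 hne hreg
  have h2 := neg_inv_le_exo (r := r) (η := η) (q := q) hne
  have h3 : exo r η 𝓜 q ≠ ⊤ := (h1.trans_lt (EReal.coe_lt_top _)).ne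
  have h4 : exo r η 𝓜 q ≠ ⊥ := ((EReal.bot_lt_coe _).trans_le h2).ne'
  refine ⟨(exo r η 𝓜 q).toReal, ?_, (EReal.coe_toReal h3 h4).symm⟩
  rw [← EReal.coe_le_coe_iff, EReal.coe_toReal h3 h4]
  exact h1.trans (EReal.coe_le_coe_iff.2 (dec_le_one hr hr1 (by positivity) _))

omit [Nonempty D] in
theorem exists_exoSup_le {q : D → ℝ} {c : ℝ} (h : exo r η 𝓜 q < (c : EReal)) :
    ∃ p ∈ stdSimplex ℝ D, ∃ g : D → D → Z → ℝ, (∀ π' π, Measurable (g π' π)) ∧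
      exoSup r η 𝓜 q p g ≤ c := by
  simp only [exo, iInf_lt_iff] at h
  obtain ⟨p, hp, g, hg, h⟩ := h
  exact ⟨p, hp, g, hg, h.le⟩

/-- Approximate minimizers for `q₀` are approximate minimizers for all nearby `q`. -/
theorem isExoMin_of_close (hr : Measurable r) (hr1 : ∀ z, r z ∈ Set.Icc (0 : ℝ) 1) (hη : 0 < η)
    (hne : 𝓜.Nonempty) (hreg : RegularClass r 𝓜) {ε κ : ℝ} (hε : 0 < ε) (hκ : 0 ≤ κ)
    (hκε : κ * (1 / η + 2 + ε) ≤ ε / 8) {q q₀ : D → ℝ} (hq : ∀ a, 0 < q a) (hq1 : ∑ a, q a = 1)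
    (hq₀ : ∀ a, 0 < q₀ a) (hq₀1 : ∑ a, q₀ a = 1) (h : ∀ a, q a ≤ (1 + κ) * q₀ a)
    (h' : ∀ a, q₀ a ≤ (1 + κ) * q a) {p : D → ℝ} {g : D → D → Z → ℝ}
    (hpg : IsExoMin r η (ε / 2) 𝓜 q₀ p g) : IsExoMin r η ε 𝓜 q p g := by
  obtain ⟨hp, hg, hmin⟩ := hpg
  obtain ⟨c, hc1, hc⟩ := exists_exo_eq_coe hr hr1 hη hne hreg hq hq1
  obtain ⟨c₀, hc₀1, hc₀⟩ := exists_exo_eq_coe hr hr1 hη hne hreg hq₀ hq₀1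
  refine ⟨hp, hg, ?_⟩
  rw [hc₀, ← EReal.coe_add] at hmin
  -- Error budget: ε/8 for a near-minimizer at q, ε/8 to transfer it to q₀, ε/2 for the given pair
  -- at q₀, ε/8 to transfer that back; 7ε/8 in total.
  have h1 : exo r η 𝓜 q < ((c + ε / 8 : ℝ) : EReal) := by
    rw [hc, EReal.coe_lt_coe_iff]; linarith
  obtain ⟨p', hp', g', hg', hle⟩ := exists_exoSup_le h1
  have h2 : c₀ ≤ c + ε / 8 + κ * (1 / η + (c + ε / 8) + 1) := by
    rw [← EReal.coe_le_coe_iff, ← hc₀]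
    refine (exo_le_exoSup hp' hg').trans (exoSup_le_iff.2 fun M hM a => ?_)
    exact exoObj_le_of_le_mul hr hr1 hη hκ h' hp' (exoSup_le_iff.1 hle M hM a)
  refine (exoSup_le_iff.2 fun M hM a =>
    exoObj_le_of_le_mul hr hr1 hη hκ h hp (exoSup_le_iff.1 hmin M hM a)).trans ?_
  rw [hc, ← EReal.coe_add, EReal.coe_le_coe_iff]
  have h3 : κ * (1 / η + (c + ε / 8) + 1) ≤ ε / 8 :=
    (mul_le_mul_of_nonneg_left (by linarith) hκ).trans hκε
  have h4 : κ * (1 / η + (c₀ + ε / 2) + 1) ≤ ε / 8 :=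
    (mul_le_mul_of_nonneg_left (by linarith) hκ).trans hκε
  linarith

/-- The cell of `q` in a countable partition into sets of small multiplicative diameter. -/
def logCell (κ : ℝ) (q : D → ℝ) (a : D) : ℤ := ⌊Real.log (q a) / Real.log (1 + κ)⌋

omit [Nonempty D] [Fintype D] in
theorem le_mul_of_logCell_eq {κ : ℝ} (hκ : 0 < κ) {q q₀ : D → ℝ} (hq : ∀ a, 0 < q a)
    (hq₀ : ∀ a, 0 < q₀ a) (h : logCell κ q = logCell κ q₀) (a : D) : q a ≤ (1 + κ) * q₀ a := by
  have hl : 0 < Real.log (1 + κ) := Real.log_pos (by linarith)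
  have h1 : ⌊Real.log (q a) / Real.log (1 + κ)⌋ = ⌊Real.log (q₀ a) / Real.log (1 + κ)⌋ :=
    congrFun h a
  have h2 := Int.lt_floor_add_one (Real.log (q a) / Real.log (1 + κ))
  have h3 := Int.floor_le (Real.log (q₀ a) / Real.log (1 + κ))
  rw [h1] at h2
  have h4 : Real.log (q a) / Real.log (1 + κ) < Real.log (q₀ a) / Real.log (1 + κ) + 1 := by
    linarith
  rw [← sub_lt_iff_lt_add', ← sub_div, div_lt_one hl] at h4
  rw [← Real.log_le_log_iff (hq a) (mul_pos (by linarith) (hq₀ a)),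
    Real.log_mul (by linarith) (hq₀ a).ne']
  linarith

/-- Approximate minimizers can be chosen measurably in the reference distribution. -/
theorem exists_measurable_selection (hr : Measurable r) (hr1 : ∀ z, r z ∈ Set.Icc (0 : ℝ) 1)
    (hη : 0 < η) (hne : 𝓜.Nonempty) (hreg : RegularClass r 𝓜) {ε : ℝ} (hε : 0 < ε) :
    ∃ (p : (D → ℝ) → D → ℝ) (g : (D → ℝ) → D → D → Z → ℝ),
      (∀ π, Measurable fun q => p q π) ∧
      (∀ π' π, Measurable fun x : (D → ℝ) × Z => g x.1 π' π x.2) ∧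
      ∀ q, (∀ a, 0 < q a) → ∑ a, q a = 1 → IsExoMin r η ε 𝓜 q (p q) (g q) := by
  classical
  set κ := ε / (8 * (1 / η + 2 + ε)) with hκ
  have hκ0 : 0 < κ := by positivity
  have hκε : κ * (1 / η + 2 + ε) ≤ ε / 8 := by
    have : 1 / η + 2 + ε ≠ 0 := by positivity
    apply le_of_eq
    rw [hκ]
    field_simp
  have hsel : ∀ c : D → ℤ, ∃ (p : D → ℝ) (g : D → D → Z → ℝ), (∀ π' π, Measurable (g π' π)) ∧
      ∀ q, (∀ a, 0 < q a) → ∑ a, q a = 1 → logCell κ q = c → IsExoMin r η ε 𝓜 q p g := by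
    intro c
    -- One representative serves its whole cell; cells without a positive probability vector get the
    -- irrelevant value 0.
    by_cases h : ∃ q₀ : D → ℝ, (∀ a, 0 < q₀ a) ∧ ∑ a, q₀ a = 1 ∧ logCell κ q₀ = c
    · obtain ⟨q₀, hq₀, hq₀1, hq₀c⟩ := h
      obtain ⟨c₀, -, hc₀⟩ := exists_exo_eq_coe hr hr1 hη hne hreg hq₀ hq₀1
      obtain ⟨p, hp, g, hg, hle⟩ := exists_exoSup_le (r := r) (η := η) (𝓜 := 𝓜) (q := q₀)
        (c := c₀ + ε / 2) (by rw [hc₀, EReal.coe_lt_coe_iff]; linarith)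
      have hmin : IsExoMin r η (ε / 2) 𝓜 q₀ p g := ⟨hp, hg, by rw [hc₀, ← EReal.coe_add]; exact hle⟩
      refine ⟨p, g, hg, fun q hq hq1 hqc => ?_⟩
      exact isExoMin_of_close hr hr1 hη hne hreg hε hκ0.le hκε hq hq1 hq₀ hq₀1
        (le_mul_of_logCell_eq hκ0 hq hq₀ (hqc.trans hq₀c.symm))
        (le_mul_of_logCell_eq hκ0 hq₀ hq (hq₀c.trans hqc.symm)) hmin
    · exact ⟨0, 0, fun _ _ => measurable_const, fun q hq hq1 hqc => absurd ⟨q, hq, hq1, hqc⟩ h⟩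
  choose p g hg hmin using hsel
  have hcell : Measurable (logCell κ : (D → ℝ) → D → ℤ) :=
    measurable_pi_lambda _ fun a =>
      Int.measurable_floor.comp ((Real.measurable_log.comp (measurable_pi_apply a)).div_const _)
  refine ⟨fun q => p (logCell κ q), fun q => g (logCell κ q), fun π => ?_, fun π' π => ?_,
    fun q hq hq1 => hmin _ q hq hq1 rfl⟩
  · exact (measurable_of_countable fun c => p c π).comp hcell
  · have h1 : Measurable fun x : (D → ℤ) × Z => g x.1 π' π x.2 :=
      measurable_from_prod_countable_right fun c => hg c π' π
    have h2 : Measurable fun x : (D → ℝ) × Z => (logCell κ x.1, x.2) :=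
      (hcell.comp measurable_fst).prodMk measurable_snd
    exact h1.comp h2

end Selection

/-! ### From a selection to a learner -/

section Realization

variable {D Z : Type*} [Fintype D]

/-- The exponential weights of a vector of cumulative reward estimates. -/
def softmax (η : ℝ) (x : D → ℝ) (π : D) : ℝ :=
  Real.exp (η * x π) / ∑ π', Real.exp (η * x π')

/-- The cumulative reward estimates of the learner that selects `(p q, g q)` when the exponential
weights are `q`. -/
def cumEstimate (η : ℝ) (p : (D → ℝ) → D → ℝ) (g : (D → ℝ) → D → D → Z → ℝ) :
    (t : ℕ) → (Fin t → D × Z) → D → ℝ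
  | 0, _ => 0
  | t + 1, h => fun π =>
      cumEstimate η p g t (fun i => h i.castSucc) π
        + g (softmax η (cumEstimate η p g t fun i => h i.castSucc)) π (h (Fin.last t)).1
            (h (Fin.last t)).2
          / p (softmax η (cumEstimate η p g t fun i => h i.castSucc)) (h (Fin.last t)).1

theorem measurable_softmax (η : ℝ) : Measurable (softmax η : (D → ℝ) → D → ℝ) := by
  have h : ∀ π, Measurable fun x : D → ℝ => Real.exp (η * x π) := fun π => by
    have hx : Measurable fun x : D → ℝ => x π := measurable_pi_apply π
    exact (hx.const_mul η).exp
  exact measurable_pi_lambda _ fun π => (h π).div (Finset.measurable_fun_sum _ fun π' _ => h π')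

variable [MeasurableSpace D] [DiscreteMeasurableSpace D] [MeasurableSpace Z]

theorem measurable_cumEstimate (η : ℝ) {p : (D → ℝ) → D → ℝ} {g : (D → ℝ) → D → D → Z → ℝ}
    (hp : ∀ π, Measurable fun q => p q π)
    (hg : ∀ π' π, Measurable fun x : (D → ℝ) × Z => g x.1 π' π x.2) :
    ∀ t, Measurable (cumEstimate η p g t) := by
  intro t
  induction t with
  | zero => exact measurable_const
  | succ t ih =>
    refine measurable_pi_lambda _ fun π => ?_
    have hinit : Measurable fun (h : Fin (t + 1) → D × Z) (i : Fin t) => h i.castSucc :=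
      measurable_pi_lambda _ fun i => measurable_pi_apply _
    have hlast : Measurable fun h : Fin (t + 1) → D × Z => h (Fin.last t) := measurable_pi_apply _
    have hc := ih.comp hinit
    have hs := (measurable_softmax η).comp hc
    have hp' : Measurable fun x : (D → ℝ) × D => p x.1 x.2 :=
      measurable_from_prod_countable_left hp
    have hg' : Measurable fun x : ((D → ℝ) × Z) × D => g x.1.1 π x.2 x.1.2 :=
      measurable_from_prod_countable_left fun d => hg π d
    exact ((measurable_pi_apply π).comp hc).add
      ((hg'.comp ((hs.prodMk hlast.snd).prodMk hlast.fst)).div (hp'.comp (hs.prodMk hlast.fst)))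

/-- A measurable selection as a function of the exponential weights is realized by a learner. -/
theorem exists_learner_of_selection (η : ℝ) (p : (D → ℝ) → D → ℝ) (g : (D → ℝ) → D → D → Z → ℝ)
    (hp : ∀ π, Measurable fun q => p q π)
    (hg : ∀ π' π, Measurable fun x : (D → ℝ) × Z => g x.1 π' π x.2) :
    ∃ L : Learner D Z, ∀ t h, L.p t h = p (L.expWeights η h) ∧ L.g t h = g (L.expWeights η h) := by
  have hm := measurable_cumEstimate η hp hg
  have hs : ∀ t, Measurable fun h : Fin t → D × Z => softmax η (cumEstimate η p g t h) := fun t =>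
    (measurable_softmax η).comp (hm t)
  -- The weights of a learner refer to its own past choices; the recursion `cumEstimate` breaks this
  -- circle, and it is identified afterwards with the sum of `L.est`.
  let L : Learner D Z :=
    { p := fun t h => p (softmax η (cumEstimate η p g t h))
      g := fun t h => g (softmax η (cumEstimate η p g t h))
      measurable_p := fun t π => (hp π).comp (hs t)
      measurable_g := fun t π' π =>
        (hg π' π).comp (((hs t).comp measurable_fst).prodMk measurable_snd) }
  have hest : ∀ t (h : Fin t → D × Z) π, ∑ i, L.est h i π = cumEstimate η p g t h π := by
    intro t
    induction t with
    | zero => intro h π; simp [cumEstimate]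
    | succ t ih =>
      intro h π
      rw [Fin.sum_univ_castSucc]
      simp only [cumEstimate]
      rw [← ih]
      rfl
  have hq : ∀ t (h : Fin t → D × Z), L.expWeights η h = softmax η (cumEstimate η p g t h) := by
    intro t h
    ext π
    simp only [Learner.expWeights, softmax, hest]
  exact ⟨L, fun t h => by rw [hq]; exact ⟨rfl, rfl⟩⟩

end Realization

/-! ### Final bounds and tuning of the learning rate -/

section MainBounds

variable {D : Type*} {Z : Type v} [Fintype D] [Nonempty D] [MeasurableSpace D]
  [DiscreteMeasurableSpace D] [MeasurableSpace Z] {r : Z → ℝ} {𝓜 : Set (Model D Z)} {T : ℕ}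

omit [Nonempty D] [DiscreteMeasurableSpace D] in
theorem regretBound_of_one_le {δ : ℝ} (hδ : 1 ≤ δ) (L : Learner D Z) (b : ℝ) :
    RegretBound.{w} r 𝓜 T L δ b := by
  intro Ω _ P _ I
  rw [ENNReal.ofReal_of_nonpos (by linarith)]
  exact zero_le

omit [Nonempty D] [DiscreteMeasurableSpace D] in
theorem RegretBound.mono {L : Learner D Z} {δ b b' : ℝ} (h : RegretBound.{w} r 𝓜 T L δ b)
    (hb : b ≤ b') : RegretBound.{w} r 𝓜 T L δ b' := by
  intro Ω _ P _ I
  exact (h Ω P I).trans (measure_mono fun ω (hω : I.regret r ω ≤ b) => hω.trans hb)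

omit [Nonempty D] [DiscreteMeasurableSpace D] in
theorem regretBound_of_forall_le {L : Learner D Z} {δ b : ℝ} (hδ : 0 < δ)
    (h : ∀ (Ω : Type w) [MeasurableSpace Ω] (P : Measure Ω) (I : Interaction 𝓜 L T P) (ω : Ω),
      I.regret r ω ≤ b) : RegretBound.{w} r 𝓜 T L δ b := by
  intro Ω _ P _ I
  have : {ω | I.regret r ω ≤ b} = Set.univ := Set.eq_univ_of_forall fun ω => h Ω P I ω
  rw [this, measure_univ, ← ENNReal.ofReal_one]
  exact ENNReal.ofReal_le_ofReal (by linarith)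

/-- The high-probability regret bound for exploration-by-optimization. -/
theorem regretBound_of_isExOPlus (hr : Measurable r) (hr1 : ∀ z, r z ∈ Set.Icc (0 : ℝ) 1)
    (hne : 𝓜.Nonempty) (hreg : RegularClass r 𝓜) {η ε : ℝ} (hη : 0 < η) {L : Learner D Z}
    (hL : IsExOPlus r η ε 𝓜 T L) {δ : ℝ} (hδ : 0 < δ) :
    RegretBound.{w} r 𝓜 T L δ
      (dec r (1 / (8 * η)) (co 𝓜) * T + 2 / η * Real.log (Fintype.card D / δ) + ε * T) := by
  intro Ω _ P _ I
  have h := I.regret_bound (r := r) hr hr1 hη (b := dec r (1 / (8 * η)) (co 𝓜) + ε) hδ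
    fun a t ht hist M hM => by
      obtain ⟨-, -, hmin⟩ := hL t ht hist
      refine (exoSup_le_iff.1 le_rfl M hM a).trans (hmin.trans ?_)
      rw [EReal.coe_add]
      exact add_le_add (exo_le_dec hr hr1 hη (L.expWeights_pos η hist) (L.sum_expWeights η hist)
        hne hreg) le_rfl
  have e : (dec r (1 / (8 * η)) (co 𝓜) + ε) * T + 2 / η * Real.log (Fintype.card D / δ)
      = dec r (1 / (8 * η)) (co 𝓜) * T + 2 / η * Real.log (Fintype.card D / δ) + ε * T := by ring
  rwa [e] at h

theorem exists_isExOPlus (hr : Measurable r) (hr1 : ∀ z, r z ∈ Set.Icc (0 : ℝ) 1)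
    (hne : 𝓜.Nonempty) (hreg : RegularClass r 𝓜) {η ε : ℝ} (hη : 0 < η) (hε : 0 < ε) (T : ℕ) :
    ∃ L : Learner D Z, IsExOPlus r η ε 𝓜 T L := by
  obtain ⟨p, g, hp, hg, hmin⟩ := exists_measurable_selection hr hr1 hη hne hreg hε
  obtain ⟨L, hL⟩ := exists_learner_of_selection (Z := Z) η p g hp hg
  refine ⟨L, fun t _ h => ?_⟩
  rw [(hL t h).1, (hL t h).2]
  exact hmin _ (L.expWeights_pos η h) (L.sum_expWeights η h)

omit [MeasurableSpace D] [DiscreteMeasurableSpace D] in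
theorem decTradeoff_term_nonneg (hr : Measurable r) (hr1 : ∀ z, r z ∈ Set.Icc (0 : ℝ) 1)
    {δ : ℝ} (hδ : 0 < δ) (hδ1 : δ < 1) (γ : {γ : ℝ // 0 < γ}) :
    0 ≤ dec r γ (co 𝓜) * T + γ * Real.log (Fintype.card D / δ) := by
  refine add_nonneg (mul_nonneg (dec_nonneg hr hr1 γ.2.le _) (Nat.cast_nonneg _))
    (mul_nonneg γ.2.le (Real.log_nonneg ?_))
  have : (1 : ℝ) ≤ Fintype.card D := by exact_mod_cast Fintype.card_pos
  rw [le_div_iff₀ hδ]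
  linarith

/-- With η = 1 / (8γ) the bound is dec T + 16 γ log + ε T. A γ with tradeoff below 2V, which exists
because V > 0, bounds the first two terms by 32 V, and ε₀ bounds the last by V; hence 33. -/
theorem exists_regretBound_of_pos (hr : Measurable r) (hr1 : ∀ z, r z ∈ Set.Icc (0 : ℝ) 1)
    (hne : 𝓜.Nonempty) (hreg : RegularClass r 𝓜) {δ : ℝ} (hδ : 0 < δ)
    (hV : 0 < decTradeoff r 𝓜 T δ) :
    ∃ η > 0, ∃ ε₀ > 0, ∀ ε : ℝ, 0 ≤ ε → ε ≤ ε₀ → ∀ L : Learner D Z, IsExOPlus r η ε 𝓜 T L →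
      RegretBound.{w} r 𝓜 T L δ (33 * decTradeoff r 𝓜 T δ) := by
  rcases le_or_gt 1 δ with hδ1 | hδ1
  · exact ⟨1, one_pos, 1, one_pos, fun _ _ _ L _ => regretBound_of_one_le hδ1 L _⟩
  set V := decTradeoff r 𝓜 T δ with hVdef
  have : Nonempty {γ : ℝ // 0 < γ} := ⟨⟨1, one_pos⟩⟩
  obtain ⟨⟨γ, hγ⟩, hlt⟩ := exists_lt_of_ciInf_lt (show decTradeoff r 𝓜 T δ < 2 * V by linarith)
  have hη : 0 < 1 / (8 * γ) := by positivity
  -- Dividing by T + 1 rather than T covers T = 0.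
  refine ⟨1 / (8 * γ), hη, V / (T + 1), by positivity, fun ε hε0 hε L hL => ?_⟩
  refine (regretBound_of_isExOPlus hr hr1 hne hreg hη hL hδ).mono ?_
  have e1 : 1 / (8 * (1 / (8 * γ))) = γ := by field_simp
  have e2 : 2 / (1 / (8 * γ)) = 16 * γ := by field_simp; norm_num
  rw [e1, e2]
  have h1 : ε * T ≤ V := by
    rw [le_div_iff₀ (by positivity)] at hε
    nlinarith
  have h2 : 0 ≤ dec r γ (co 𝓜) * T :=
    mul_nonneg (dec_nonneg hr hr1 hγ.le _) (Nat.cast_nonneg _)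
  simp only at hlt
  linarith

omit [MeasurableSpace D] [DiscreteMeasurableSpace D] in
/-- If the tradeoff vanishes, some fixed sampling distribution has no regret at all. -/
theorem exists_no_regret_of_nonpos (hr : Measurable r) (hr1 : ∀ z, r z ∈ Set.Icc (0 : ℝ) 1)
    (hne : 𝓜.Nonempty) {δ : ℝ} (hδ : 0 < δ) (hδ1 : δ < 1) (hT : 0 < T)
    (hV : decTradeoff r 𝓜 T δ ≤ 0) :
    ∃ p ∈ stdSimplex ℝ D, ∀ M ∈ 𝓜, ∀ a,
      ∑ π, p π * (meanReward r M a - meanReward r M π) ≤ 0 := by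
  obtain ⟨M₀, hM₀⟩ := hne
  have hcard : (1 : ℝ) ≤ Fintype.card D := by exact_mod_cast Fintype.card_pos
  have hT1 : (1 : ℝ) ≤ T := by exact_mod_cast hT
  set l := Real.log (Fintype.card D / δ) with hl
  have hl0 : 0 < l := Real.log_pos (by rw [lt_div_iff₀ hδ]; linarith)
  have : Nonempty {γ : ℝ // 0 < γ} := ⟨⟨1, one_pos⟩⟩
  -- A γ with tradeoff below x has dec ≤ x and γ ≤ x / l. The regret is then at most 2x, with one x
  -- for the accuracy of p, plus the penalty 2γ ≤ 2x / l. Compactness of the simplex lets x tend to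
  -- 0.
  have hstep : ∀ x : ℝ, 0 < x → ∃ p ∈ stdSimplex ℝ D, ∀ M ∈ 𝓜, ∀ a,
      ∑ π, p π * (meanReward r M a - meanReward r M π) ≤ x * (2 + 2 / l) := by
    intro x hx
    obtain ⟨⟨γ, hγ⟩, hlt⟩ := exists_lt_of_ciInf_lt (hV.trans_lt hx)
    simp only at hlt
    have hd0 := dec_nonneg hr hr1 hγ.le (co 𝓜)
    have h1 : dec r γ (co 𝓜) ≤ x := by nlinarith [mul_pos hγ hl0]
    have h2 : γ ≤ x / l := by
      rw [le_div_iff₀ hl0]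
      nlinarith
    obtain ⟨p, hp, hpd⟩ := exists_decPayoff_le hr hr1 hγ.le (subset_co hM₀) hx
    refine ⟨p, hp, fun M hM a => ?_⟩
    have h3 := decPayoff_ge (r := r) hγ.le hp M M₀
    have h4 := hpd M (subset_co hM)
    have h5 : ∑ π, p π * (meanReward r M a - meanReward r M π)
        ≤ ∑ π, p π * ((⨆ π', meanReward r M π') - meanReward r M π) :=
      Finset.sum_le_sum fun π _ => mul_le_mul_of_nonneg_left
        (sub_le_sub_right (meanReward_le_iSup M a) _) (hp.1 π)
    have h6 : x * (2 + 2 / l) = 2 * x + 2 * (x / l) := by ring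
    linarith
  choose p hp hpx using fun n : ℕ => hstep (1 / (n + 1)) Nat.one_div_pos_of_nat
  set 𝒰 : Ultrafilter ℕ := Ultrafilter.of atTop with h𝒰
  have h𝒰le : (𝒰 : Filter ℕ) ≤ atTop := Ultrafilter.of_le _
  choose p' hp' hlim using fun π => exists_tendsto_ultrafilter 𝒰 (fun n => p n π) 0 1
    fun n => ⟨(hp n).1 π, by
      rw [← (hp n).2]
      exact Finset.single_le_sum (fun b _ => (hp n).1 b) (Finset.mem_univ π)⟩
  refine ⟨p', ⟨fun π => (hp' π).1, ?_⟩, fun M hM a => ?_⟩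
  · refine tendsto_nhds_unique (tendsto_finsetSum Finset.univ fun π _ => hlim π) ?_
    simp only [(hp _).2]
    exact tendsto_const_nhds
  · refine le_of_tendsto_of_tendsto (tendsto_finsetSum Finset.univ fun π _ =>
      (hlim π).mul_const _) ?_ (Eventually.of_forall fun n => hpx n M hM a)
    have := (tendsto_one_div_add_atTop_nhds_zero_nat (𝕜 := ℝ)).mul_const (2 + 2 / l)
    rw [zero_mul] at this
    exact this.mono_left h𝒰le

omit [DiscreteMeasurableSpace D] in
/-- A sampling distribution without regret is played by exploration-by-optimization with a
sufficiently large learning rate. -/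
theorem exists_isExOPlus_of_no_regret (hne : 𝓜.Nonempty) {p : D → ℝ} (hp : p ∈ stdSimplex ℝ D)
    (hpM : ∀ M ∈ 𝓜, ∀ a, ∑ π, p π * (meanReward r M a - meanReward r M π) ≤ 0)
    {ε δ : ℝ} (hε : 0 < ε) (hδ : 0 < δ) :
    ∃ η > 0, ∃ L : Learner D Z, IsExOPlus r η ε 𝓜 T L ∧ RegretBound.{w} r 𝓜 T L δ 0 := by
  have hη : 0 < 1 / ε := by positivity
  -- With g = 0 the exponential moment is 1, so the objective is at most 0, while the minimax value
  -- is at least -1/η = -ε; so (p, 0) is an ε-minimizer.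
  refine ⟨1 / ε, hη, ⟨fun _ _ => p, fun _ _ _ _ _ => 0, fun _ _ => measurable_const,
    fun _ _ _ => measurable_const⟩, fun t _ h => ⟨hp, fun _ _ => measurable_const, ?_⟩,
    regretBound_of_forall_le hδ fun Ω _ P I ω => ?_⟩
  · set L : Learner D Z := ⟨fun _ _ => p, fun _ _ _ _ _ => 0, fun _ _ => measurable_const,
      fun _ _ _ => measurable_const⟩
    have h1 : exoSup r (1 / ε) 𝓜 (L.expWeights (1 / ε) h) p (fun _ _ _ => 0) ≤ ((0 : ℝ) : EReal) := by
      refine exoSup_le_iff.2 fun M hM a => (exoObj_le_iff hη).2 ?_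
      have h2 : 1 ≤ 1 + 1 / ε * (0 - ∑ π, p π * (meanReward r M a - meanReward r M π)) := by
        have := mul_nonneg hη.le (neg_nonneg.2 (hpM M hM a))
        linarith
      refine ⟨?_, zero_le_one.trans h2⟩
      have h3 : exoMoment (1 / ε) (L.expWeights (1 / ε) h) p (fun _ _ _ => (0 : ℝ)) a M = 1 := by
        simp only [exoMoment, sub_self, mul_zero, Real.exp_zero, mul_one]
        rw [← ENNReal.ofReal_sum_of_nonneg fun π _ => (L.expWeights_pos _ h π).le,
          L.sum_expWeights]
        simp only [ENNReal.ofReal_one, lintegral_one, measure_univ, mul_one]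
        rw [← ENNReal.ofReal_sum_of_nonneg fun π _ => hp.1 π, hp.2, ENNReal.ofReal_one]
      rw [h3, ← ENNReal.ofReal_one]
      exact ENNReal.ofReal_le_ofReal h2
    refine h1.trans ?_
    have h4 := neg_inv_le_exo (r := r) (η := 1 / ε) (q := L.expWeights (1 / ε) h) hne
    rw [one_div_one_div] at h4
    calc ((0 : ℝ) : EReal) = ((-ε : ℝ) : EReal) + ((ε : ℝ) : EReal) := by
          rw [← EReal.coe_add]; simp
      _ ≤ _ := add_le_add h4 le_rfl
  · exact ciSup_le fun a => Finset.sum_nonpos fun t ht =>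
      hpM _ (I.model_mem t (Finset.mem_range.1 ht) ω) a

/-- For δ ≥ 1 any run will do. For δ < 1 the tradeoff is nonnegative: if positive, the tuned
algorithm applies with error min(ε, ε₀); if zero, there is nothing to play (T = 0) or a no-regret
distribution exists. -/
theorem exists_isExOPlus_regretBound (hr : Measurable r) (hr1 : ∀ z, r z ∈ Set.Icc (0 : ℝ) 1)
    (hne : 𝓜.Nonempty) (hreg : RegularClass r 𝓜) {δ ε : ℝ} (hδ : 0 < δ) (hε : 0 < ε) :
    ∃ η > 0, ∃ L : Learner D Z, IsExOPlus r η ε 𝓜 T L ∧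
      RegretBound.{w} r 𝓜 T L δ (33 * decTradeoff r 𝓜 T δ) := by
  rcases le_or_gt 1 δ with hδ1 | hδ1
  · obtain ⟨L, hL⟩ := exists_isExOPlus hr hr1 hne hreg one_pos hε T
    exact ⟨1, one_pos, L, hL, regretBound_of_one_le hδ1 L _⟩
  rcases lt_or_ge 0 (decTradeoff r 𝓜 T δ) with hV | hV
  · obtain ⟨η, hη, ε₀, hε₀, h⟩ := exists_regretBound_of_pos.{v, w} hr hr1 hne hreg hδ hV
    obtain ⟨L, hL⟩ := exists_isExOPlus hr hr1 hne hreg hη (lt_min hε hε₀) T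
    refine ⟨η, hη, L, fun t ht hist => ?_, h _ (lt_min hε hε₀).le (min_le_right _ _) L hL⟩
    obtain ⟨h1, h2, h3⟩ := hL t ht hist
    exact ⟨h1, h2, h3.trans (add_le_add le_rfl (EReal.coe_le_coe_iff.2 (min_le_left _ _)))⟩
  · have : Nonempty {γ : ℝ // 0 < γ} := ⟨⟨1, one_pos⟩⟩
    have hV0 : decTradeoff r 𝓜 T δ = 0 :=
      le_antisymm hV (le_ciInf fun γ => decTradeoff_term_nonneg hr hr1 hδ hδ1 γ)
    rw [hV0, mul_zero]
    rcases T.eq_zero_or_pos with rfl | hT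
    · obtain ⟨L, hL⟩ := exists_isExOPlus hr hr1 hne hreg one_pos hε 0
      refine ⟨1, one_pos, L, hL, regretBound_of_forall_le hδ fun Ω _ P I ω => ?_⟩
      simp [Interaction.regret]
    · obtain ⟨p, hp, hpM⟩ := exists_no_regret_of_nonpos hr hr1 hne hδ hδ1 hT hV
      exact exists_isExOPlus_of_no_regret hne hp hpM hε hδ

end MainBounds

end AdvDM

end

theorem mainTheorem1 :
    ∃ C : ℝ, 0 < C ∧
      ∀ (D : Type u) (Z : Type v) [Fintype D] [Nonempty D] [MeasurableSpace D]
        [DiscreteMeasurableSpace D] [MeasurableSpace Z]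
        (r : Z → ℝ), Measurable r → (∀ z, r z ∈ Set.Icc (0 : ℝ) 1) →
      ∀ 𝓜 : Set (AdvDM.Model D Z), 𝓜.Nonempty → AdvDM.RegularClass r 𝓜 → ∀ T : ℕ,
        (∀ η ε : ℝ, 0 < η → 0 ≤ ε → ∀ L : AdvDM.Learner D Z, AdvDM.IsExOPlus r η ε 𝓜 T L →
          ∀ δ : ℝ, 0 < δ → AdvDM.RegretBound.{w} r 𝓜 T L δ
            (AdvDM.dec r (1 / (8 * η)) (AdvDM.co 𝓜) * T
              + 2 / η * Real.log (Fintype.card D / δ) + ε * T)) ∧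
        (∀ η ε : ℝ, 0 < η → 0 < ε → ∃ L : AdvDM.Learner D Z, AdvDM.IsExOPlus r η ε 𝓜 T L) ∧
        (∀ δ : ℝ, 0 < δ → 0 < AdvDM.decTradeoff r 𝓜 T δ → ∃ η > 0, ∃ ε₀ > 0,
          ∀ ε : ℝ, 0 ≤ ε → ε ≤ ε₀ → ∀ L : AdvDM.Learner D Z, AdvDM.IsExOPlus r η ε 𝓜 T L →
            AdvDM.RegretBound.{w} r 𝓜 T L δ (C * AdvDM.decTradeoff r 𝓜 T δ)) ∧
        (∀ δ ε : ℝ, 0 < δ → 0 < ε → ∃ η > 0, ∃ L : AdvDM.Learner D Z,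
          AdvDM.IsExOPlus r η ε 𝓜 T L ∧
            AdvDM.RegretBound.{w} r 𝓜 T L δ (C * AdvDM.decTradeoff r 𝓜 T δ)) := by
  refine ⟨33, by norm_num, ?_⟩
  intro D Z _ _ _ _ _ r hr hr1 𝓜 hne hreg T
  refine ⟨fun η ε hη _ L hL δ hδ => AdvDM.regretBound_of_isExOPlus hr hr1 hne hreg hη hL hδ,
    fun η ε hη hε => AdvDM.exists_isExOPlus hr hr1 hne hreg hη hε T,
    fun δ hδ hV => AdvDM.exists_regretBound_of_pos hr hr1 hne hreg hδ hV,
    fun δ ε hδ hε => AdvDM.exists_isExOPlus_regretBound hr hr1 hne hreg hδ hε⟩
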